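/- There is a function $C:\mathbb R\to\mathbb R$ such that the following holds. Let $n\ge 1$, let $X_1,\dots,X_n$ be i.i.d. random variables with mean zero, unit variance and finite fourth moment, and let $A=(a_{ij})_{1\le i,j\le n}$ be a real symmetric matrix with $a_{ii}=0$ for all $i$ and $A\neq 0$. Put $$\sigma_n^2=2\sum_{i=1}^n\sum_{j=1}^n a_{ij}^2,\qquad \sigma_n>0,\qquad W_n=\frac1{\sigma_n}\sum_{i\ne j}a_{ij}X_iX_j ,$$ where the last sum runs over all ordered pairs of distinct indices. Then, for every $z\in\mathbb R$, $$\bigl|P(W_n\le z)-\Phi(z)\bigr|\le \frac{C(EX_1^4)\,EX_1^4}{(1+|z|)^2\sigma_n^2}\left(\sqrt{\sum_{i}\Bigl(\sum_j a_{ij}^2\Bigr)^2}+\sqrt{\sum_{i,j}\Bigl(\sum_k a_{ik}a_{jk}\Bigr)^2}\right),$$ where $\Phi$ is the standard normal distribution function. Thus the constant depends only on $EX_1^4$. -/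

import Mathlib

open MeasureTheory ProbabilityTheory

noncomputable section

/-- The normalisation `σ_n`, the square root of `σ_n² = 2 ∑ᵢ ∑ⱼ aᵢⱼ²`. -/
def quadSigma {n : ℕ} (A : Matrix (Fin n) (Fin n) ℝ) : ℝ :=
  Real.sqrt (2 * ∑ i, ∑ j, A i j ^ 2)

/-- The normalised quadratic form `W_n = σ_n⁻¹ ∑_{i ≠ j} aᵢⱼ Xᵢ Xⱼ`, the sum running over all
ordered pairs of distinct indices. -/
def quadForm {n : ℕ} {Ω : Type*} (A : Matrix (Fin n) (Fin n) ℝ) (X : Fin n → Ω → ℝ) (ω : Ω) : ℝ :=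
  (quadSigma A)⁻¹ * ∑ i, ∑ j with i ≠ j, A i j * X i ω * X j ω

/-- The standard normal distribution function `Φ`. -/
def stdNormalCDF (z : ℝ) : ℝ := cdf (gaussianReal 0 1) z

end

/-! ### The normal distribution function and its Mills ratio. -/

section Auxiliary

open Filter Topology Set

/-! The proof is Stein's method for an exchangeable pair, with signs kept in the error term. Scale
the matrix to `a = A / σ`, so that `∑ a i j ^ 2 = 1 / 2`; write `W = ∑ a i j X_i X_j` and `L_i = ∑ a
i j X_j`, and take an independent copy `X'`. Swapping `X_i` with `X'_i` preserves the law and lowers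
`W` by `D_i = 2 (X_i - X'_i) L_i`.

Let `f` solve Stein's equation `f' w = w f w + 1_{w ≤ z} - Φ z`. Since `w f w` increases and the
indicator decreases, the trapezoidal rule for `f` between two points has an error controlled by the
increment of the increasing function `h w = w f w - 1_{w ≤ z}`, up to an additive constant.
Integrating over each swap, dividing by 4 and summing over `i` (`abs_stein_biForm_le`) gives `|E V
f'(W) - E W f(W)| ≤ E S h(W)`, where `V = ∑ (X_i - X'_i)² L_i²` and `S = ∑ (X_i - X'_i)|X_i - X'_i|
L_i|L_i|`. As `P(W ≤ z) - Φ z = E f'(W) - E W f(W)`, Cauchy–Schwarz leaves the error `‖1 - V‖₂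
‖f'(W)‖₂ + ‖S‖₂ ‖h(W)‖₂`.

The factors `f'(W)` and `h(W)` carry the decay in `z`: both functions are `O((1 + w²) / (1 +
|z|)²)`, and `W` has a fourth moment bounded in terms of `E X⁴` (`fourth_moment_biForm`). The
factors `1 - V` and `S` are small because they are built from sums of centred weights `g(X_i, X'_i)`
times functions of `L_i`. Such a sum is almost orthogonal, with second moment `O(∑_i (∑_j a i j ^
2)²)` (`weighted_sum_sq`). The antisymmetry of the weight in `S` is what makes it centred; with
absolute values this gain would be lost. The one further piece of `1 - V` is the quadratic form of
the off-diagonal part of `a²`, which produces the second square root. -/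

theorem stdNormalCDF_nonneg (w : ℝ) : 0 ≤ stdNormalCDF w := cdf_nonneg _ _

theorem stdNormalCDF_le_one (w : ℝ) : stdNormalCDF w ≤ 1 := cdf_le_one _ _

theorem stdNormalCDF_eq_integral (w : ℝ) :
    stdNormalCDF w = ∫ s in Iic w, gaussianPDFReal 0 1 s := by
  rw [stdNormalCDF, cdf_eq_real, Measure.real, gaussianReal_apply_eq_integral 0 one_ne_zero,
    ENNReal.toReal_ofReal]
  exact integral_nonneg fun _ => gaussianPDFReal_nonneg _ _ _

theorem hasDerivAt_stdNormalCDF (w : ℝ) :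
    HasDerivAt stdNormalCDF (gaussianPDFReal 0 1 w) w := by
  have hc : Continuous (gaussianPDFReal 0 1) := by
    rw [gaussianPDFReal_def]; fun_prop
  have h : stdNormalCDF = fun w => stdNormalCDF 0 + ∫ s in (0 : ℝ)..w, gaussianPDFReal 0 1 s := by
    funext w
    have := intervalIntegral.integral_Iic_sub_Iic (μ := volume) (a := 0) (b := w)
      (integrable_gaussianPDFReal 0 1).integrableOn (integrable_gaussianPDFReal 0 1).integrableOn
    rw [stdNormalCDF_eq_integral, stdNormalCDF_eq_integral, ← this]; ring
  rw [h]
  exact (intervalIntegral.integral_hasDerivAt_right (hc.intervalIntegrable _ _)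
    (hc.stronglyMeasurableAtFilter _ _) hc.continuousAt).const_add _

theorem stdNormalCDF_neg (w : ℝ) : stdNormalCDF (-w) = 1 - stdNormalCDF w := by
  have hna : NullSingletonClass (gaussianReal 0 1) := nullSingletonClass_gaussianReal one_ne_zero
  have h1 : (gaussianReal 0 1).real (Iic (-w)) = (gaussianReal 0 1).real (Ioi w) := by
    have h := gaussianReal_map_neg (μ := 0) (v := 1)
    rw [neg_zero] at h
    conv_lhs => rw [← h]
    rw [map_measureReal_apply (by fun_prop) measurableSet_Iic]
    have : (fun x : ℝ => -x) ⁻¹' Iic (-w) = Ici w := by ext; simp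
    rw [this, measureReal_congr Ioi_ae_eq_Ici.symm]
  rw [stdNormalCDF, stdNormalCDF, cdf_eq_real, cdf_eq_real, h1, ← compl_Iic,
    probReal_compl_eq_one_sub measurableSet_Iic]

/-- The Mills ratio `Φ / Φ'` of the standard normal law. -/
noncomputable def millsRatio (w : ℝ) : ℝ :=
  Real.sqrt (2 * Real.pi) * Real.exp (w ^ 2 / 2) * stdNormalCDF w

theorem millsRatio_nonneg (w : ℝ) : 0 ≤ millsRatio w :=
  mul_nonneg (by positivity) (stdNormalCDF_nonneg w)

theorem sqrt_two_pi_pos : 0 < Real.sqrt (2 * Real.pi) := by positivity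

theorem sqrt_mul_gaussianPDFReal (w : ℝ) :
    Real.sqrt (2 * Real.pi) * gaussianPDFReal 0 1 w = Real.exp (-w ^ 2 / 2) := by
  have := sqrt_two_pi_pos.ne'
  rw [gaussianPDFReal]
  simp only [NNReal.coe_one, mul_one, sub_zero]
  rw [mul_inv_cancel_left₀ this]

theorem hasDerivAt_exp_neg_sq (w : ℝ) :
    HasDerivAt (fun w : ℝ => Real.exp (-w ^ 2 / 2)) (-w * Real.exp (-w ^ 2 / 2)) w := by
  have h : HasDerivAt (fun w : ℝ => -w ^ 2 / 2) (-w) w := by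
    refine (((hasDerivAt_id' w).pow 2).neg.div_const 2).congr_deriv ?_
    norm_num
    ring
  convert h.exp using 1; ring

theorem hasDerivAt_millsRatio (w : ℝ) : HasDerivAt millsRatio (1 + w * millsRatio w) w := by
  have h : HasDerivAt (fun w : ℝ => w ^ 2 / 2) w w := by
    refine (((hasDerivAt_id' w).pow 2).div_const 2).congr_deriv ?_
    norm_num
  have h2 := (h.exp.const_mul (Real.sqrt (2 * Real.pi))).mul (hasDerivAt_stdNormalCDF w)
  refine h2.congr_deriv ?_
  have h3 := sqrt_mul_gaussianPDFReal w
  have h4 : Real.exp (w ^ 2 / 2) * Real.exp (-w ^ 2 / 2) = 1 := by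
    rw [← Real.exp_add]; simp [neg_div]
  rw [millsRatio]
  linear_combination Real.exp (w ^ 2 / 2) * h3 + h4

theorem tendsto_exp_neg_sq_atBot :
    Tendsto (fun w : ℝ => Real.exp (-w ^ 2 / 2)) atBot (𝓝 0) := by
  refine Real.tendsto_exp_atBot.comp ?_
  refine tendsto_atBot_mono' _ ?_ tendsto_id
  filter_upwards [eventually_le_atBot (-2 : ℝ)] with w hw
  simp only [id]; nlinarith

theorem millsRatio_eq (w : ℝ) : millsRatio w * Real.exp (-w ^ 2 / 2) =
    Real.sqrt (2 * Real.pi) * stdNormalCDF w := by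
  have h4 : Real.exp (w ^ 2 / 2) * Real.exp (-w ^ 2 / 2) = 1 := by
    rw [← Real.exp_add]; simp [neg_div]
  rw [millsRatio]
  linear_combination Real.sqrt (2 * Real.pi) * stdNormalCDF w * h4

theorem tendsto_sqrt_mul_stdNormalCDF :
    Tendsto (fun w => Real.sqrt (2 * Real.pi) * stdNormalCDF w) atBot (𝓝 0) := by
  rw [← mul_zero (Real.sqrt (2 * Real.pi))]
  exact (tendsto_cdf_atBot (gaussianReal 0 1)).const_mul (Real.sqrt (2 * Real.pi))

/-- The expression is the derivative of `w * millsRatio w`, so this is what makes that product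
increasing. Multiplied by the Gaussian weight and divided by `1 + w ^ 2` it becomes `F`, which
vanishes at `-∞` and has positive derivative. -/
theorem millsRatio_lower (w : ℝ) : 0 ≤ (1 + w ^ 2) * millsRatio w + w := by
  set F : ℝ → ℝ := fun w => Real.sqrt (2 * Real.pi) * stdNormalCDF w +
    w / (1 + w ^ 2) * Real.exp (-w ^ 2 / 2) with hF
  have hder : ∀ w, HasDerivAt F (Real.exp (-w ^ 2 / 2) * (2 / (1 + w ^ 2) ^ 2)) w := by
    intro w
    have h0 : 1 + w ^ 2 ≠ 0 := by positivity
    have h1 : HasDerivAt (fun w : ℝ => 1 + w ^ 2) (2 * w) w := by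
      simpa using ((hasDerivAt_id w).pow 2).const_add 1
    have h2 := (((hasDerivAt_id w).div h1 h0).mul (hasDerivAt_exp_neg_sq w))
    refine (((hasDerivAt_stdNormalCDF w).const_mul (Real.sqrt (2 * Real.pi))).add h2).congr_deriv ?_
    rw [sqrt_mul_gaussianPDFReal]
    simp only [id, Pi.div_apply]
    field_simp
    ring
  have hmono : Monotone F := monotone_of_hasDerivAt_nonneg hder fun w => by positivity
  have hlim : Tendsto F atBot (𝓝 0) := by
    have h2 : Tendsto (fun w : ℝ => w / (1 + w ^ 2) * Real.exp (-w ^ 2 / 2)) atBot (𝓝 0) := by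
      refine squeeze_zero_norm (fun w => ?_) tendsto_exp_neg_sq_atBot
      rw [norm_mul, Real.norm_of_nonneg (Real.exp_pos _).le]
      refine mul_le_of_le_one_left (Real.exp_pos _).le ?_
      rw [Real.norm_eq_abs, abs_div, abs_of_pos (by positivity : 0 < 1 + w ^ 2),
        div_le_one (by positivity), abs_le]
      constructor <;> nlinarith [sq_nonneg (w - 1), sq_nonneg (w + 1)]
    rw [← add_zero (0 : ℝ)]
    exact tendsto_sqrt_mul_stdNormalCDF.add h2
  have h := hmono.le_of_tendsto hlim w
  have he := Real.exp_pos (-w ^ 2 / 2)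
  have h1 : 0 < 1 + w ^ 2 := by positivity
  rw [hF] at h
  simp only [← millsRatio_eq] at h
  have h3 : 0 ≤ (millsRatio w + w / (1 + w ^ 2)) * Real.exp (-w ^ 2 / 2) := by linarith
  have h4 := nonneg_of_mul_nonneg_left h3 he
  have h5 := mul_nonneg h1.le h4
  rwa [mul_add, mul_div_cancel₀ _ h1.ne'] at h5

/-- This is the derivative of `millsRatio`, and on the negative axis the classical Gaussian tail
bound: there `F`, the gap between the two sides of that bound, increases from its limit 0 at `-∞`.
-/
theorem one_add_mul_millsRatio_nonneg (w : ℝ) : 0 ≤ 1 + w * millsRatio w := by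
  rcases le_or_gt 0 w with hw | hw
  · have := mul_nonneg hw (millsRatio_nonneg w); linarith
  set F : ℝ → ℝ := fun w => -(w⁻¹ * Real.exp (-w ^ 2 / 2)) -
    Real.sqrt (2 * Real.pi) * stdNormalCDF w with hF
  have hder : ∀ w < 0, HasDerivAt F (Real.exp (-w ^ 2 / 2) * (w ^ 2)⁻¹) w := by
    intro w hw
    have h2 := (((hasDerivAt_inv hw.ne).mul (hasDerivAt_exp_neg_sq w))).neg
    refine (h2.sub ((hasDerivAt_stdNormalCDF w).const_mul (Real.sqrt (2 * Real.pi)))).congr_deriv ?_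
    rw [sqrt_mul_gaussianPDFReal]
    field_simp [hw.ne]
    ring
  have hmono : MonotoneOn F (Iio 0) := by
    refine monotoneOn_of_hasDerivWithinAt_nonneg (f' := fun w => Real.exp (-w ^ 2 / 2) * (w ^ 2)⁻¹)
      (convex_Iio 0)
      (fun x hx => (hder x hx).continuousAt.continuousWithinAt) ?_ (fun x hx => by positivity)
    intro x hx
    rw [interior_Iio] at hx
    exact (hder x hx).hasDerivWithinAt
  have hlim : Tendsto F atBot (𝓝 0) := by
    have := (tendsto_inv_atBot_zero.mul tendsto_exp_neg_sq_atBot).neg.sub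
      tendsto_sqrt_mul_stdNormalCDF
    rw [mul_zero, neg_zero, sub_zero] at this
    exact this
  have h : 0 ≤ F w := le_of_tendsto hlim (by
    filter_upwards [eventually_le_atBot w] with s hs
    exact hmono (show s < 0 by linarith) hw hs)
  have he := Real.exp_pos (-w ^ 2 / 2)
  rw [hF] at h
  simp only [← millsRatio_eq] at h
  have h3 : 0 ≤ (-w⁻¹ - millsRatio w) * Real.exp (-w ^ 2 / 2) := by linarith
  have h4 := nonneg_of_mul_nonneg_left h3 he
  have h5 := mul_nonneg (neg_nonneg.2 hw.le) h4
  have h6 : w * w⁻¹ = 1 := mul_inv_cancel₀ hw.ne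
  nlinarith

theorem monotone_millsRatio : Monotone millsRatio :=
  monotone_of_hasDerivAt_nonneg hasDerivAt_millsRatio one_add_mul_millsRatio_nonneg

theorem monotone_mul_millsRatio : Monotone fun w => w * millsRatio w := by
  refine monotone_of_hasDerivAt_nonneg (f' := fun w => (1 + w ^ 2) * millsRatio w + w)
    (fun w => ?_) millsRatio_lower
  refine ((hasDerivAt_id w).mul (hasDerivAt_millsRatio w)).congr_deriv ?_
  simp only [id]; ring

theorem stdNormalCDF_neg_le_exp {z : ℝ} (hz : 0 ≤ z) :
    stdNormalCDF (-z) ≤ Real.exp (-z ^ 2 / 2) := by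
  have h0 : millsRatio (-z) ≤ millsRatio 0 := monotone_millsRatio (by linarith)
  have h1 : millsRatio 0 ≤ Real.sqrt (2 * Real.pi) := by
    rw [millsRatio]; simp only [ne_eq, OfNat.ofNat_ne_zero, not_false_eq_true, zero_pow, zero_div,
      Real.exp_zero, mul_one]
    exact mul_le_of_le_one_right sqrt_two_pi_pos.le (stdNormalCDF_le_one 0)
  have h2 := millsRatio_eq (-z)
  have h3 : Real.sqrt (2 * Real.pi) * stdNormalCDF (-z) ≤
      Real.sqrt (2 * Real.pi) * Real.exp (-z ^ 2 / 2) := by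
    rw [← h2, neg_sq]
    exact mul_le_mul_of_nonneg_right (h0.trans h1) (Real.exp_pos _).le
  exact le_of_mul_le_mul_left h3 sqrt_two_pi_pos

theorem exp_neg_le_inv {x : ℝ} (hx : 0 ≤ x) : Real.exp (-x) ≤ (1 + x)⁻¹ := by
  rw [Real.exp_neg]
  exact inv_anti₀ (by linarith) (by linarith [Real.add_one_le_exp x])

theorem stdNormalCDF_neg_le {z : ℝ} (hz : 0 ≤ z) : stdNormalCDF (-z) ≤ 2 / (1 + z ^ 2) := by
  refine (stdNormalCDF_neg_le_exp hz).trans ?_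
  have := exp_neg_le_inv (x := z ^ 2 / 2) (by positivity)
  rw [neg_div]
  refine this.trans ?_
  rw [inv_eq_one_div, div_le_div_iff₀ (by positivity) (by positivity)]
  nlinarith [sq_nonneg z]

/-! ### Stein's equation: monotonicity and increments of its solution. -/

/-- The bounded solution of Stein's equation `f' w - w f w = 1_{w ≤ z} - Φ z`. -/
noncomputable def steinSol (z w : ℝ) : ℝ :=
  if w ≤ z then stdNormalCDF (-z) * millsRatio w else stdNormalCDF z * millsRatio (-w)

theorem steinSol_of_le {z w : ℝ} (h : w ≤ z) :
    steinSol z w = stdNormalCDF (-z) * millsRatio w := if_pos h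

theorem steinSol_of_ge {z w : ℝ} (h : z ≤ w) :
    steinSol z w = stdNormalCDF z * millsRatio (-w) := by
  rcases h.lt_or_eq with h | rfl
  · exact if_neg h.not_ge
  · rw [steinSol_of_le le_rfl, millsRatio, millsRatio, neg_sq]; ring

theorem steinSol_neg (z w : ℝ) : steinSol (-z) (-w) = steinSol z w := by
  rcases le_total w z with h | h
  · rw [steinSol_of_le h, steinSol_of_ge (neg_le_neg h), neg_neg]
  · rw [steinSol_of_ge h, steinSol_of_le (neg_le_neg h), neg_neg]

theorem steinSol_nonneg (z w : ℝ) : 0 ≤ steinSol z w := by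
  rw [steinSol]
  split_ifs <;> exact mul_nonneg (stdNormalCDF_nonneg _) (millsRatio_nonneg _)

theorem steinSol_le (z w : ℝ) : steinSol z w ≤ millsRatio z + millsRatio (-z) := by
  have h1 := millsRatio_nonneg z
  have h2 := millsRatio_nonneg (-z)
  rcases le_total w z with h | h
  · rw [steinSol_of_le h]
    have := mul_le_of_le_one_left (millsRatio_nonneg w) (stdNormalCDF_le_one (-z))
    linarith [monotone_millsRatio h]
  · rw [steinSol_of_ge h]
    have := mul_le_of_le_one_left (millsRatio_nonneg (-w)) (stdNormalCDF_le_one z)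
    linarith [monotone_millsRatio (neg_le_neg h)]

theorem measurable_steinSol (z : ℝ) : Measurable (steinSol z) :=
  Measurable.ite measurableSet_Iic (monotone_millsRatio.measurable.const_mul _)
    ((monotone_millsRatio.measurable.comp measurable_neg).const_mul _)

/-- On each side of `z` this is monotonicity of `w * millsRatio w`, reflected for `w ≥ z`; the two
formulas agree at `z`, so the pieces join. -/
theorem monotone_mul_steinSol (z : ℝ) : Monotone fun w => w * steinSol z w := by
  have h1 : ∀ a b, a ≤ b → b ≤ z → a * steinSol z a ≤ b * steinSol z b := by
    intro a b hab hb
    rw [steinSol_of_le hb, steinSol_of_le (hab.trans hb)]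
    have := mul_le_mul_of_nonneg_left (monotone_mul_millsRatio hab) (stdNormalCDF_nonneg (-z))
    simp only at this; nlinarith
  have h2 : ∀ a b, a ≤ b → z ≤ a → a * steinSol z a ≤ b * steinSol z b := by
    intro a b hab ha
    rw [steinSol_of_ge ha, steinSol_of_ge (ha.trans hab)]
    have := mul_le_mul_of_nonneg_left (monotone_mul_millsRatio (neg_le_neg hab))
      (stdNormalCDF_nonneg z)
    simp only at this; nlinarith
  intro a b hab
  rcases le_total b z with hb | hb
  · exact h1 a b hab hb
  rcases le_total z a with ha | ha
  · exact h2 a b hab ha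
  · exact (h1 a z ha le_rfl).trans (h2 z b hb le_rfl)

theorem sub_bounds_of_hasDerivAt {g g' : ℝ → ℝ} {a b l u : ℝ} (hab : a ≤ b)
    (hg : ∀ x, HasDerivAt g (g' x) x) (hl : ∀ x, a < x → x < b → l ≤ g' x)
    (hu : ∀ x, a < x → x < b → g' x ≤ u) :
    (b - a) * l ≤ g b - g a ∧ g b - g a ≤ (b - a) * u := by
  rcases hab.eq_or_lt with rfl | h
  · simp
  obtain ⟨c, hc, hc'⟩ := exists_hasDerivAt_eq_slope g g' h
    (fun x _ => (hg x).continuousAt.continuousWithinAt) (fun x _ => hg x)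
  have hba : 0 < b - a := by linarith
  rw [eq_div_iff hba.ne'] at hc'
  rw [← hc', mul_comm (g' c)]
  exact ⟨mul_le_mul_of_nonneg_left (hl c hc.1 hc.2) hba.le,
    mul_le_mul_of_nonneg_left (hu c hc.1 hc.2) hba.le⟩

theorem steinSol_sub_of_le {z a b : ℝ} (hab : a ≤ b) (hb : b ≤ z) :
    (b - a) * (a * steinSol z a + stdNormalCDF (-z)) ≤ steinSol z b - steinSol z a ∧
    steinSol z b - steinSol z a ≤ (b - a) * (b * steinSol z b + stdNormalCDF (-z)) := by
  have key := sub_bounds_of_hasDerivAt (g := fun w => stdNormalCDF (-z) * millsRatio w)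
    (l := a * steinSol z a + stdNormalCDF (-z)) (u := b * steinSol z b + stdNormalCDF (-z)) hab
    (fun x => (hasDerivAt_millsRatio x).const_mul _)
    (fun x h1 h2 => by
      have := monotone_mul_steinSol z h1.le
      simp only [steinSol_of_le (h2.le.trans hb)] at this
      linarith)
    (fun x h1 h2 => by
      have := monotone_mul_steinSol z h2.le
      simp only [steinSol_of_le (h2.le.trans hb)] at this
      linarith)
  simpa only [← steinSol_of_le hb, ← steinSol_of_le (hab.trans hb)] using key

theorem steinSol_sub_of_ge {z a b : ℝ} (hab : a ≤ b) (ha : z ≤ a) :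
    (b - a) * (a * steinSol z a - stdNormalCDF z) ≤ steinSol z b - steinSol z a ∧
    steinSol z b - steinSol z a ≤ (b - a) * (b * steinSol z b - stdNormalCDF z) := by
  have h := steinSol_sub_of_le (neg_le_neg hab) (neg_le_neg ha)
  simp only [steinSol_neg, neg_neg] at h
  constructor
  · linarith [h.2]
  · linarith [h.1]

/-- The indicator of `(-∞, z]`, shifted so that it vanishes near `0`. -/
noncomputable def steinStep (z w : ℝ) : ℝ :=
  (if w ≤ z then 1 else 0) - (if 0 ≤ z then 1 else 0)

/-- The constant for which `w * steinSol z w + steinStep z w + steinConst z` is the derivative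
of `steinSol z`. -/
noncomputable def steinConst (z : ℝ) : ℝ := (if 0 ≤ z then 1 else 0) - stdNormalCDF z

theorem steinStep_add_steinConst (z w : ℝ) :
    steinStep z w + steinConst z = (if w ≤ z then 1 else 0) - stdNormalCDF z := by
  rw [steinStep, steinConst]; ring

theorem antitone_steinStep (z : ℝ) : Antitone (steinStep z) := by
  intro a b hab
  unfold steinStep
  have : (if b ≤ z then (1 : ℝ) else 0) ≤ if a ≤ z then 1 else 0 := by
    split_ifs <;> linarith
  linarith

/-- The derivative is an increasing function plus a decreasing one plus a constant. On `[a, b]` its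
extremes are therefore bounded by evaluating the two monotone parts at opposite ends. -/
theorem steinSol_sub_bounds {z a b : ℝ} (hab : a ≤ b) :
    (b - a) * (a * steinSol z a + steinStep z b + steinConst z) ≤ steinSol z b - steinSol z a ∧
    steinSol z b - steinSol z a ≤
      (b - a) * (b * steinSol z b + steinStep z a + steinConst z) := by
  rw [add_assoc, add_assoc, steinStep_add_steinConst, steinStep_add_steinConst]
  have hn := stdNormalCDF_neg z
  rcases le_or_gt b z with hb | hb
  · rw [if_pos hb, if_pos (hab.trans hb), ← hn]
    exact steinSol_sub_of_le hab hb
  rw [if_neg hb.not_ge]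
  have hm := monotone_mul_steinSol z
  rcases lt_or_ge z a with ha | ha
  · rw [if_neg ha.not_ge, zero_sub, ← sub_eq_add_neg, ← sub_eq_add_neg]
    exact steinSol_sub_of_ge hab ha.le
  -- The derivative jumps inside the interval: add the bounds on `[a, z]` and `[z, b]`, using that
  -- the indicator drops by 1 at `z`.
  rw [if_pos ha, ← hn]
  obtain ⟨h1, h2⟩ := steinSol_sub_of_le ha le_rfl
  obtain ⟨h3, h4⟩ := steinSol_sub_of_ge hb.le le_rfl
  have h5 := hm ha
  have h6 := hm hb.le
  simp only at h5 h6
  have ha' : 0 ≤ z - a := by linarith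
  have hb' : 0 ≤ b - z := by linarith
  constructor
  · nlinarith [mul_nonneg hb' (sub_nonneg.2 h5), mul_nonneg ha' (sub_nonneg.2 h5)]
  · nlinarith [mul_nonneg ha' (sub_nonneg.2 h6)]

/-! ### Bounds for the Stein solution that decay in `z`, and the trapezoidal rule. -/

/-- Quadratic growth in `w` is traded for quadratic decay in `z`. For `w ≤ 0` the factor `Φ(-z)` is
itself small; for `w ≥ z` the product is at most 1 while `1 + w ^ 2 ≥ 1 + z ^ 2`; for `0 < w < z` it
is at most `(w / z) exp (-(z² - w²) / 2)`. -/
theorem abs_mul_steinSol_le_of_nonneg {z : ℝ} (hz : 0 ≤ z) (w : ℝ) :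
    |w * steinSol z w| ≤ 2 * (1 + w ^ 2) / (1 + z ^ 2) := by
  have hz1 : 0 < 1 + z ^ 2 := by positivity
  rcases le_or_gt w 0 with hw | hw
  · rw [steinSol_of_le (hw.trans hz)]
    have h1 := one_add_mul_millsRatio_nonneg w
    have h2 := mul_nonneg (neg_nonneg.2 hw) (millsRatio_nonneg w)
    have h3 := stdNormalCDF_nonneg (-z)
    have : |w * (stdNormalCDF (-z) * millsRatio w)| ≤ stdNormalCDF (-z) := by
      rw [abs_le]; constructor <;> nlinarith
    refine this.trans ((stdNormalCDF_neg_le hz).trans ?_)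
    gcongr
    nlinarith [sq_nonneg w]
  rw [abs_of_nonneg (mul_nonneg hw.le (steinSol_nonneg z w))]
  rcases le_total z w with h | h
  · rw [steinSol_of_ge h]
    have h1 := one_add_mul_millsRatio_nonneg (-w)
    have h2 := mul_nonneg hw.le (millsRatio_nonneg (-w))
    have h3 := stdNormalCDF_nonneg z
    have h4 := stdNormalCDF_le_one z
    have : w * (stdNormalCDF z * millsRatio (-w)) ≤ 1 := by nlinarith
    refine this.trans ?_
    rw [le_div_iff₀ hz1]
    nlinarith
  · rw [steinSol_of_le h]
    have hz0 : 0 < z := hw.trans_le h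
    have h1 := one_add_mul_millsRatio_nonneg (-z)
    have h2 : stdNormalCDF (-z) * (z * Real.sqrt (2 * Real.pi)) ≤ Real.exp (-z ^ 2 / 2) := by
      have h3 := millsRatio_eq (-z)
      rw [neg_sq] at h3
      have h4 := Real.exp_pos (-z ^ 2 / 2)
      nlinarith
    have h3 : millsRatio w ≤ Real.sqrt (2 * Real.pi) * Real.exp (w ^ 2 / 2) :=
      mul_le_of_le_one_right (by positivity) (stdNormalCDF_le_one w)
    have h4 : z * (w * (stdNormalCDF (-z) * millsRatio w)) ≤
        w * (Real.exp (-z ^ 2 / 2) * Real.exp (w ^ 2 / 2)) := by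
      calc z * (w * (stdNormalCDF (-z) * millsRatio w))
          ≤ z * (w * (stdNormalCDF (-z) * (Real.sqrt (2 * Real.pi) * Real.exp (w ^ 2 / 2)))) := by
            have := stdNormalCDF_nonneg (-z)
            gcongr
        _ = w * ((stdNormalCDF (-z) * (z * Real.sqrt (2 * Real.pi))) * Real.exp (w ^ 2 / 2)) := by
            ring
        _ ≤ _ := by gcongr
    rw [← Real.exp_add] at h4
    have h5 : Real.exp (-z ^ 2 / 2 + w ^ 2 / 2) ≤ 2 * (1 + w ^ 2) / (1 + z ^ 2) := by
      have hzw : w ^ 2 ≤ z ^ 2 := by nlinarith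
      have := exp_neg_le_inv (x := (z ^ 2 - w ^ 2) / 2) (by linarith)
      rw [show -z ^ 2 / 2 + w ^ 2 / 2 = -((z ^ 2 - w ^ 2) / 2) by ring]
      refine this.trans ?_
      rw [inv_eq_one_div, div_le_div_iff₀ (by linarith) hz1]
      nlinarith [sq_nonneg w]
    have h6 : z * (w * (stdNormalCDF (-z) * millsRatio w)) ≤
        z * (2 * (1 + w ^ 2) / (1 + z ^ 2)) := by
      refine h4.trans ?_
      calc w * Real.exp (-z ^ 2 / 2 + w ^ 2 / 2) ≤ w * (2 * (1 + w ^ 2) / (1 + z ^ 2)) := by gcongr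
        _ ≤ _ := by gcongr
    exact le_of_mul_le_mul_left h6 hz0

theorem two_div_le (z w : ℝ) :
    2 * (1 + w ^ 2) / (1 + z ^ 2) ≤ 4 * (1 + w ^ 2) / (1 + |z|) ^ 2 := by
  rw [div_le_div_iff₀ (by positivity) (by positivity)]
  have : (1 + |z|) ^ 2 ≤ 2 * (1 + z ^ 2) := by nlinarith [sq_nonneg (|z| - 1), sq_abs z]
  nlinarith [sq_nonneg w]

theorem abs_mul_steinSol_le (z w : ℝ) :
    |w * steinSol z w| ≤ 4 * (1 + w ^ 2) / (1 + |z|) ^ 2 := by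
  refine le_trans ?_ (two_div_le z w)
  rcases le_total 0 z with hz | hz
  · exact abs_mul_steinSol_le_of_nonneg hz w
  · have := abs_mul_steinSol_le_of_nonneg (neg_nonneg.2 hz) (-w)
    rwa [steinSol_neg, neg_sq, neg_sq, neg_mul, abs_neg] at this

/-- The shifted indicator vanishes unless `|z| ≤ |w|`; this is the purpose of the shift. -/
theorem abs_steinStep_le (z w : ℝ) : |steinStep z w| ≤ 4 * (1 + w ^ 2) / (1 + |z|) ^ 2 := by
  refine le_trans ?_ (two_div_le z w)
  have hz1 : 0 < 1 + z ^ 2 := by positivity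
  rw [le_div_iff₀ hz1]
  unfold steinStep
  split_ifs with h1 h2 h2
  · simp; positivity
  · simp; nlinarith [sq_nonneg w]
  · simp; nlinarith [sq_nonneg w]
  · simp; positivity

theorem abs_steinConst_le (z w : ℝ) : |steinConst z| ≤ 4 * (1 + w ^ 2) / (1 + |z|) ^ 2 := by
  refine le_trans ?_ (two_div_le z w)
  have h0 : 2 / (1 + z ^ 2) ≤ 2 * (1 + w ^ 2) / (1 + z ^ 2) := by
    gcongr; nlinarith [sq_nonneg w]
  refine le_trans ?_ h0
  unfold steinConst
  split_ifs with h
  · rw [← stdNormalCDF_neg, abs_of_nonneg (stdNormalCDF_nonneg _)]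
    exact stdNormalCDF_neg_le h
  · rw [zero_sub, abs_neg, abs_of_nonneg (stdNormalCDF_nonneg _)]
    have := stdNormalCDF_neg_le (z := -z) (by linarith)
    rwa [neg_neg, neg_sq] at this

/-- A bound with no growth in `w` but a poor dependence on `z`. It serves only integrability, where
a bounded factor is needed against the merely integrable squared increments. -/
theorem abs_mul_steinSol_le_const (z w : ℝ) :
    |w * steinSol z w| ≤ 1 + |z| * (millsRatio z + millsRatio (-z)) := by
  have hM := add_nonneg (millsRatio_nonneg z) (millsRatio_nonneg (-z))
  have hpos := mul_nonneg (abs_nonneg z) hM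
  have hs := steinSol_nonneg z w
  have h1 : ∀ c x, 0 ≤ c → c ≤ 1 → x ≤ 0 → |x * (c * millsRatio x)| ≤ 1 := by
    intro c x hc0 hc1 hx
    have h1 := one_add_mul_millsRatio_nonneg x
    have h2 := mul_nonneg (neg_nonneg.2 hx) (millsRatio_nonneg x)
    rw [abs_le]; constructor <;> nlinarith
  by_cases hwz : |w| ≤ |z|
  · rw [abs_mul, abs_of_nonneg hs]
    have := mul_le_mul hwz (steinSol_le z w) hs (abs_nonneg z)
    linarith
  have hwz : |z| < |w| := not_le.1 hwz
  rcases le_total w z with h | h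
  · have hw : w ≤ 0 := by
      by_contra hw
      have hw := not_le.1 hw
      rw [abs_of_pos hw] at hwz
      linarith [le_abs_self z]
    rw [steinSol_of_le h]
    linarith [h1 _ w (stdNormalCDF_nonneg (-z)) (stdNormalCDF_le_one _) hw]
  · have hw : 0 ≤ w := by
      by_contra hw
      have hw := not_le.1 hw
      rw [abs_of_neg hw] at hwz
      linarith [neg_abs_le z]
    rw [steinSol_of_ge h]
    have := h1 _ (-w) (stdNormalCDF_nonneg z) (stdNormalCDF_le_one _) (by linarith)
    rw [neg_mul, abs_neg] at this
    linarith

theorem abs_steinStep_le_one (z w : ℝ) : |steinStep z w| ≤ 1 := by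
  unfold steinStep
  split_ifs <;> norm_num

/-- Trapezoidal rule for the solution of Stein's equation. -/
theorem abs_steinSol_trapezoid_le (z a b : ℝ) :
    |(a - b) ^ 2 * ((a * steinSol z a + steinStep z a + steinConst z) +
        (b * steinSol z b + steinStep z b + steinConst z)) / 2 -
      (a - b) * (steinSol z a - steinSol z b)| ≤
    (a - b) * |a - b| * ((a * steinSol z a - steinStep z a) -
      (b * steinSol z b - steinStep z b)) / 2 := by
  rcases le_total b a with h | h
  · obtain ⟨h1, h2⟩ := steinSol_sub_bounds (z := z) h
    have h0 : 0 ≤ a - b := by linarith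
    rw [abs_of_nonneg h0, abs_le]
    constructor <;> nlinarith [mul_le_mul_of_nonneg_left h1 h0, mul_le_mul_of_nonneg_left h2 h0]
  · obtain ⟨h1, h2⟩ := steinSol_sub_bounds (z := z) h
    have h0 : 0 ≤ b - a := by linarith
    rw [abs_of_nonpos (by linarith : a - b ≤ 0), abs_le]
    constructor <;> nlinarith [mul_le_mul_of_nonneg_left h1 h0, mul_le_mul_of_nonneg_left h2 h0]

/-! ### Cauchy–Schwarz and comparison of moments. -/

section CauchySchwarz

variable {Ω : Type*} [MeasurableSpace Ω] {μ : Measure Ω} {f g : Ω → ℝ}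

theorem integrable_mul_of_sq (hf : Measurable f) (hg : Measurable g)
    (hf2 : Integrable (fun x => f x ^ 2) μ) (hg2 : Integrable (fun x => g x ^ 2) μ) :
    Integrable (fun x => f x * g x) μ := by
  refine (hf2.add hg2).mono' (hf.mul hg).aestronglyMeasurable (.of_forall fun x => ?_)
  rw [Real.norm_eq_abs, abs_le]
  simp only [Pi.add_apply]
  constructor <;> nlinarith [sq_nonneg (f x + g x), sq_nonneg (f x - g x), sq_nonneg (f x),
    sq_nonneg (g x)]

theorem sq_integral_mul_le (hf : Measurable f) (hg : Measurable g)
    (hf2 : Integrable (fun x => f x ^ 2) μ) (hg2 : Integrable (fun x => g x ^ 2) μ) :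
    (∫ x, f x * g x ∂μ) ^ 2 ≤ (∫ x, f x ^ 2 ∂μ) * ∫ x, g x ^ 2 ∂μ := by
  have hfg := integrable_mul_of_sq hf hg hf2 hg2
  have key : ∀ t : ℝ, 0 ≤ (∫ x, f x ^ 2 ∂μ) * (t * t) + (2 * ∫ x, f x * g x ∂μ) * t +
      ∫ x, g x ^ 2 ∂μ := by
    intro t
    have h : 0 ≤ ∫ x, (t * f x + g x) ^ 2 ∂μ := integral_nonneg fun x => sq_nonneg _
    have h2 : ∫ x, (t * f x + g x) ^ 2 ∂μ =
        ∫ x, (((fun x => t ^ 2 * f x ^ 2) + fun x => 2 * t * (f x * g x)) + fun x => g x ^ 2) x ∂μ := by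
      congr 1; funext x; simp only [Pi.add_apply]; ring
    rw [h2, integral_add' ((hf2.const_mul _).add (hfg.const_mul _)) hg2,
      integral_add' (hf2.const_mul _) (hfg.const_mul _), integral_const_mul, integral_const_mul] at h
    linarith
  have := discrim_le_zero key
  rw [discrim] at this
  linarith

theorem abs_integral_mul_le {A B : ℝ} (hA : 0 ≤ A) (hB : 0 ≤ B) (hf : Measurable f)
    (hg : Measurable g) (hf2 : Integrable (fun x => f x ^ 2) μ)
    (hg2 : Integrable (fun x => g x ^ 2) μ) (hfA : ∫ x, f x ^ 2 ∂μ ≤ A ^ 2)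
    (hgB : ∫ x, g x ^ 2 ∂μ ≤ B ^ 2) : |∫ x, f x * g x ∂μ| ≤ A * B := by
  refine abs_le_of_sq_le_sq ?_ (mul_nonneg hA hB)
  rw [mul_pow]
  exact (sq_integral_mul_le hf hg hf2 hg2).trans
    (mul_le_mul hfA hgB (integral_nonneg fun x => sq_nonneg _) (sq_nonneg A))

theorem integral_sq_le_of_fourth [IsProbabilityMeasure μ] {A : ℝ} (hA : 0 ≤ A) (hf : Measurable f)
    (hf4 : Integrable (fun x => f x ^ 4) μ) (hfA : ∫ x, f x ^ 4 ∂μ ≤ A ^ 2) :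
    Integrable (fun x => f x ^ 2) μ ∧ ∫ x, f x ^ 2 ∂μ ≤ A := by
  have h4 : Integrable (fun x => (f x ^ 2) ^ 2) μ := by
    simpa only [← pow_mul] using hf4
  have hA4 : ∫ x, (f x ^ 2) ^ 2 ∂μ ≤ A ^ 2 := by simpa only [← pow_mul] using hfA
  have h1 : Integrable (fun _ : Ω => (1 : ℝ) ^ 2) μ := integrable_const _
  have hi := integrable_mul_of_sq (hf.pow_const 2) measurable_const h4 h1
  have := abs_integral_mul_le hA zero_le_one (hf.pow_const 2) measurable_const h4 h1 hA4 (by simp)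
  simp only [mul_one] at this hi
  exact ⟨hi, (le_abs_self _).trans this⟩

end CauchySchwarz

/-! ### Linear and quadratic forms on a product space, and independence of coordinates. -/

theorem integral_comp_of_measurePreserving {α β : Type*} [MeasurableSpace α] [MeasurableSpace β]
    {μ : Measure α} {ν : Measure β} {f : α → β} (hf : MeasurePreserving f μ ν) {u : β → ℝ}
    (hu : Measurable u) : ∫ x, u (f x) ∂μ = ∫ y, u y ∂ν := by
  rw [← hf.map_eq, integral_map hf.measurable.aemeasurable hu.aestronglyMeasurable]

/-- `F` does not depend on the coordinate `i`. -/
def FreeOf {ι S : Type*} [DecidableEq ι] (i : ι) (F : (ι → S) → ℝ) : Prop :=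
  ∀ x s, F (Function.update x i s) = F x

theorem sum_insert_quadratic {ι : Type*} [DecidableEq ι] {a : ι → ι → ℝ}
    (ha : ∀ i j, a i j = a j i) (ha0 : ∀ i, a i i = 0) {k : ι} {T : Finset ι} (hk : k ∉ T)
    (y : ι → ℝ) : ∑ i ∈ insert k T, ∑ j ∈ insert k T, a i j * y i * y j =
      (∑ i ∈ T, ∑ j ∈ T, a i j * y i * y j) + y k * (2 * ∑ j ∈ T, a k j * y j) := by
  simp only [Finset.sum_insert hk, Finset.sum_add_distrib, ha0, Finset.mul_sum]
  have h1 : ∀ i, a i k * y i * y k = y k * (a k i * y i) := fun i => by rw [ha i k]; ring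
  have h2 : ∀ i, a k i * y k * y i = y k * (a k i * y i) := fun i => by ring
  have h3 : ∀ i, y k * (2 * (a k i * y i)) = y k * (a k i * y i) + y k * (a k i * y i) :=
    fun i => by ring
  simp only [h1, h2, h3, Finset.sum_add_distrib]
  ring

section Forms

variable {ι S : Type*} [Fintype ι] {X : S → ℝ}

/-- Linear form in the variables `X (x j)`. -/
def linForm (X : S → ℝ) (c : ι → ℝ) (x : ι → S) : ℝ := ∑ j, c j * X (x j)

/-- Quadratic form in the variables `X (x j)`. -/
def biForm (X : S → ℝ) (a : ι → ι → ℝ) (x : ι → S) : ℝ :=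
  ∑ i, ∑ j, a i j * X (x i) * X (x j)

theorem measurable_linForm [MeasurableSpace S] (hX : Measurable X) (c : ι → ℝ) : Measurable (linForm X c) :=
  Finset.measurable_sum _ fun j _ => (hX.comp (measurable_pi_apply j)).const_mul _

theorem measurable_biForm [MeasurableSpace S] (hX : Measurable X) (a : ι → ι → ℝ) : Measurable (biForm X a) :=
  Finset.measurable_sum _ fun i _ => Finset.measurable_sum _ fun j _ =>
    ((hX.comp (measurable_pi_apply i)).const_mul _).mul (hX.comp (measurable_pi_apply j))

theorem freeOf_linForm [DecidableEq ι] {i : ι} {c : ι → ℝ} (hc : c i = 0) : FreeOf i (linForm X c) := by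
  intro x s
  refine Finset.sum_congr rfl fun j _ => ?_
  by_cases hj : j = i
  · subst hj; simp [hc]
  · rw [Function.update_of_ne hj]

end Forms

section Coord

variable {ι S : Type*} [Fintype ι] [MeasurableSpace S] {ρ : Measure S}
  [IsProbabilityMeasure ρ] {i : ι} {u : S → ℝ}

theorem integral_comp_eval (hu : Measurable u) :
    ∫ x : ι → S, u (x i) ∂(Measure.pi fun _ => ρ) = ∫ s, u s ∂ρ :=
  integral_comp_of_measurePreserving (measurePreserving_eval (fun _ : ι => ρ) i) hu

theorem integrable_comp_coord (hu : Integrable u ρ) :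
    Integrable (fun x : ι → S => u (x i)) (Measure.pi fun _ => ρ) :=
  (measurePreserving_eval (fun _ : ι => ρ) i).integrable_comp_of_integrable hu

end Coord

section Pi

variable {ι S : Type*} [Fintype ι] [DecidableEq ι] [MeasurableSpace S] {ρ : Measure S}
  [IsProbabilityMeasure ρ] {i : ι} {F : (ι → S) → ℝ} {u : S → ℝ}

theorem indepFun_of_freeOf (hF : Measurable F) (h : FreeOf i F) :
    IndepFun (fun x : ι → S => x i) F (Measure.pi fun _ => ρ) := by
  obtain ⟨s₀⟩ := nonempty_of_isProbabilityMeasure ρ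
  have hind : iIndepFun (fun (j : ι) (x : ι → S) => x j) (Measure.pi fun _ => ρ) :=
    iIndepFun_pi (X := fun _ s => s) fun _ => aemeasurable_id
  have h2 := hind.indepFun_finset {i} (Finset.univ.erase i) (by simp)
    fun j => measurable_pi_apply j
  -- Filling coordinate `i` with a fixed `s₀` exhibits `F` as a function of the other coordinates
  -- alone.
  set ext : ((j : (Finset.univ.erase i : Finset ι)) → S) → ι → S :=
    fun y k => if hk : k ∈ Finset.univ.erase i then y ⟨k, hk⟩ else s₀ with hext
  have hextm : Measurable ext := by
    refine measurable_pi_lambda _ fun k => ?_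
    by_cases hk : k ∈ Finset.univ.erase i
    · simp only [hext, hk, dif_pos]; exact measurable_pi_apply _
    · simp only [hext, hk, dif_neg, not_false_eq_true]; exact measurable_const
  have hev : Measurable fun y : ({i} : Finset ι) → S => y ⟨i, Finset.mem_singleton_self i⟩ :=
    measurable_pi_apply (X := fun _ : ({i} : Finset ι) => S) _
  have h3 := h2.comp (φ := fun y : ({i} : Finset ι) → S => y ⟨i, Finset.mem_singleton_self i⟩)
    (ψ := F ∘ ext) hev (hF.comp hextm)
  have e : (F ∘ ext) ∘ (fun (x : ι → S) (k : (Finset.univ.erase i : Finset ι)) => x k) = F := by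
    funext x
    rw [← h x s₀]
    simp only [Function.comp]
    congr 1
    funext k
    by_cases hk : k = i
    · subst hk; simp [hext]
    · simp [hext, hk]
  rw [e] at h3
  exact h3

theorem integral_mul_of_freeOf (hu : Measurable u) (hF : Measurable F) (h : FreeOf i F) :
    ∫ x : ι → S, u (x i) * F x ∂(Measure.pi fun _ => ρ) =
      (∫ s, u s ∂ρ) * ∫ x, F x ∂(Measure.pi fun _ => ρ) := by
  rw [← integral_comp_eval (ι := ι) (i := i) hu]
  exact ((indepFun_of_freeOf (ρ := ρ) hF h).comp hu measurable_id).integral_fun_mul_eq_mul_integral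
    (hu.comp (measurable_pi_apply i)).aestronglyMeasurable hF.aestronglyMeasurable

theorem integrable_mul_of_freeOf (hu : Measurable u) (hF : Measurable F) (h : FreeOf i F)
    (hui : Integrable u ρ) (hFi : Integrable F (Measure.pi fun _ : ι => ρ)) :
    Integrable (fun x : ι → S => u (x i) * F x) (Measure.pi fun _ => ρ) :=
  ((indepFun_of_freeOf (ρ := ρ) hF h).comp hu measurable_id).integrable_mul
    (integrable_comp_coord hui) hFi

variable {X : S → ℝ}

/-- Induction step for fourth moments, adding one variable independent of `p` and `q`. The term `4
p³ X q` has mean zero, and `E p² q² ≤ A B` by Cauchy–Schwarz. -/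
theorem fourth_moment_step {p q : (ι → S) → ℝ} {A B b : ℝ} (hX : Measurable X)
    (hX0 : ∫ s, X s ∂ρ = 0) (hX2 : ∫ s, X s ^ 2 ∂ρ = 1) (hX4 : Integrable (fun s => X s ^ 4) ρ)
    (hb : ∫ s, X s ^ 4 ∂ρ = b)
    (hp : Measurable p) (hq : Measurable q) (hpi : FreeOf i p) (hqi : FreeOf i q)
    (hp4 : Integrable (fun x => p x ^ 4) (Measure.pi fun _ => ρ))
    (hq4 : Integrable (fun x => q x ^ 4) (Measure.pi fun _ => ρ))
    (hA : 0 ≤ A) (hB : 0 ≤ B) (hpA : ∫ x, p x ^ 4 ∂(Measure.pi fun _ => ρ) ≤ A ^ 2)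
    (hqB : ∫ x, q x ^ 4 ∂(Measure.pi fun _ => ρ) ≤ B ^ 2) :
    Integrable (fun x => (p x + X (x i) * q x) ^ 4) (Measure.pi fun _ => ρ) ∧
    ∫ x, (p x + X (x i) * q x) ^ 4 ∂(Measure.pi fun _ => ρ) ≤
      A ^ 2 + 8 * A * B + 3 * b * B ^ 2 := by
  set P : Measure (ι → S) := Measure.pi fun _ => ρ
  have hXe : Measurable fun x : ι → S => X (x i) := hX.comp (measurable_pi_apply i)
  have hX1i : Integrable X ρ := by
    refine ((integrable_const (1 : ℝ)).add hX4).mono' hX.aestronglyMeasurable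
      (.of_forall fun s => ?_)
    rw [Real.norm_eq_abs, abs_le]; simp only [Pi.add_apply]
    constructor <;> nlinarith [sq_nonneg (X s ^ 2 - 1), sq_nonneg (X s - 1), sq_nonneg (X s + 1)]
  have hX2i : Integrable (fun s => X s ^ 2) ρ := by
    refine ((integrable_const (1 : ℝ)).add hX4).mono' (hX.pow_const 2).aestronglyMeasurable
      (.of_forall fun s => ?_)
    rw [Real.norm_eq_abs, abs_le]; simp only [Pi.add_apply]
    constructor <;> nlinarith [sq_nonneg (X s ^ 2 - 1), sq_nonneg (X s ^ 2)]
  have hp22 : Integrable (fun x => (p x ^ 2) ^ 2) P := by simpa only [← pow_mul] using hp4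
  have hq22 : Integrable (fun x => (q x ^ 2) ^ 2) P := by simpa only [← pow_mul] using hq4
  have hpq : Integrable (fun x => p x ^ 2 * q x ^ 2) P :=
    integrable_mul_of_sq (hp.pow_const 2) (hq.pow_const 2) hp22 hq22
  have hppq : Integrable (fun x => p x ^ 3 * q x) P := by
    refine (hp4.add hpq).mono' ((hp.pow_const 3).mul hq).aestronglyMeasurable
      (.of_forall fun s => ?_)
    rw [Real.norm_eq_abs, abs_le]; simp only [Pi.add_apply]
    constructor <;> nlinarith [sq_nonneg (p s ^ 2 - p s * q s), sq_nonneg (p s ^ 2 + p s * q s),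
      sq_nonneg (p s ^ 2), sq_nonneg (p s * q s)]
  have f1 : FreeOf i fun x => p x ^ 3 * q x := fun x s => by
    simp only [hpi x s, hqi x s]
  have f2 : FreeOf i fun x => p x ^ 2 * q x ^ 2 := fun x s => by
    simp only [hpi x s, hqi x s]
  have f3 : FreeOf i fun x => q x ^ 4 := fun x s => by simp only [hqi x s]
  have m1 : Measurable fun x => p x ^ 3 * q x := (hp.pow_const 3).mul hq
  have m2 : Measurable fun x => p x ^ 2 * q x ^ 2 := (hp.pow_const 2).mul (hq.pow_const 2)
  have m3 : Measurable fun x => q x ^ 4 := hq.pow_const 4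
  have i1 := (integrable_mul_of_freeOf hX m1 f1 hX1i hppq).const_mul 4
  have i2 := (integrable_mul_of_freeOf (hX.pow_const 2) m2 f2 hX2i hpq).const_mul 8
  have i3 := (integrable_mul_of_freeOf (hX.pow_const 4) m3 f3 hX4 hq4).const_mul 3
  -- The cubic term satisfies `4 p X³ q³ ≤ 2 p² X² q² + 2 X⁴ q⁴`, which turns the binomial
  -- coefficients 6 and 1 into 8 and 3.
  have ipt : ∀ x : ι → S, (p x + X (x i) * q x) ^ 4 ≤
      p x ^ 4 + 4 * (X (x i) * (p x ^ 3 * q x)) + 8 * (X (x i) ^ 2 * (p x ^ 2 * q x ^ 2)) +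
        3 * (X (x i) ^ 4 * q x ^ 4) := by
    intro x
    nlinarith [sq_nonneg (X (x i) * (p x * q x) - X (x i) ^ 2 * q x ^ 2)]
  have iD := ((hp4.add i1).add i2).add i3
  refine ⟨?_, ?_⟩
  · refine iD.mono' ((hp.add (hXe.mul hq)).pow_const 4).aestronglyMeasurable
      (.of_forall fun x => ?_)
    rw [Real.norm_of_nonneg (by positivity)]
    exact ipt x
  · have hle : ∫ x, (p x + X (x i) * q x) ^ 4 ∂P ≤ _ :=
      integral_mono_of_nonneg (.of_forall fun x => by positivity) iD (.of_forall ipt)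
    refine hle.trans ?_
    rw [integral_add' ((hp4.add i1).add i2) i3, integral_add' (hp4.add i1) i2,
      integral_add' hp4 i1,
      integral_const_mul, integral_const_mul, integral_const_mul,
      integral_mul_of_freeOf hX m1 f1, integral_mul_of_freeOf (hX.pow_const 2) m2 f2,
      integral_mul_of_freeOf (hX.pow_const 4) m3 f3, hX0, hX2, hb]
    have hAB := (le_abs_self _).trans (abs_integral_mul_le hA hB (hp.pow_const 2) (hq.pow_const 2)
      hp22 hq22 (by simpa only [← pow_mul] using hpA) (by simpa only [← pow_mul] using hqB))
    have hb0 : 0 ≤ b := hb ▸ integral_nonneg fun s => by positivity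
    have := mul_le_mul_of_nonneg_left hqB hb0
    linarith

theorem one_le_fourth_moment (hX : Measurable X) (hX2 : ∫ s, X s ^ 2 ∂ρ = 1)
    (hX4 : Integrable (fun s => X s ^ 4) ρ) : 1 ≤ ∫ s, X s ^ 4 ∂ρ := by
  have h0 : 0 ≤ ∫ s, X s ^ 4 ∂ρ := integral_nonneg fun s => by positivity
  have := (integral_sq_le_of_fourth (Real.sqrt_nonneg _) hX hX4 (Real.sq_sqrt h0).ge).2
  rw [hX2, Real.one_le_sqrt] at this
  exact this

theorem fourth_moment_sum (hX : Measurable X) (hX0 : ∫ s, X s ∂ρ = 0) (hX2 : ∫ s, X s ^ 2 ∂ρ = 1)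
    (hX4 : Integrable (fun s => X s ^ 4) ρ) {b : ℝ} (hb : ∫ s, X s ^ 4 ∂ρ = b) (c : ι → ℝ)
    (T : Finset ι) :
    Integrable (fun x : ι → S => (∑ j ∈ T, c j * X (x j)) ^ 4) (Measure.pi fun _ => ρ) ∧
    ∫ x : ι → S, (∑ j ∈ T, c j * X (x j)) ^ 4 ∂(Measure.pi fun _ => ρ) ≤
      (4 * b * ∑ j ∈ T, c j ^ 2) ^ 2 := by
  have hb1 : 1 ≤ b := hb ▸ one_le_fourth_moment hX hX2 hX4
  induction T using Finset.induction_on with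
  | empty => simp
  | insert k T hk ih =>
    have hs : 0 ≤ ∑ j ∈ T, c j ^ 2 := Finset.sum_nonneg fun j _ => sq_nonneg _
    have hm : Measurable fun x : ι → S => ∑ j ∈ T, c j * X (x j) :=
      Finset.measurable_sum _ fun j _ => (hX.comp (measurable_pi_apply j)).const_mul _
    have hfree : FreeOf k fun x : ι → S => ∑ j ∈ T, c j * X (x j) := fun x s =>
      Finset.sum_congr rfl fun j hj => by
        rw [Function.update_of_ne (ne_of_mem_of_not_mem hj hk)]
    have := fourth_moment_step (ρ := ρ) (i := k) (q := fun _ => c k) (A := 4 * b * ∑ j ∈ T, c j ^ 2)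
      (B := c k ^ 2) hX hX0 hX2 hX4 hb
      hm measurable_const hfree (fun _ _ => rfl) ih.1 (integrable_const _)
      (by positivity) (sq_nonneg _) ih.2 (by simp [← pow_mul])
    have e : ∀ x : ι → S, ∑ j ∈ insert k T, c j * X (x j) =
        (∑ j ∈ T, c j * X (x j)) + X (x k) * c k := fun x => by
      rw [Finset.sum_insert hk]; ring
    simp only [e]
    refine ⟨this.1, this.2.trans ?_⟩
    rw [Finset.sum_insert hk]
    set s := ∑ j ∈ T, c j ^ 2
    have h1 : b * (s * c k ^ 2) ≤ b ^ 2 * (s * c k ^ 2) :=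
      mul_le_mul_of_nonneg_right (by nlinarith) (by positivity)
    have h2 : b * (c k ^ 2) ^ 2 ≤ b ^ 2 * (c k ^ 2) ^ 2 :=
      mul_le_mul_of_nonneg_right (by nlinarith) (by positivity)
    have h3 : 0 ≤ b ^ 2 * (c k ^ 2) ^ 2 := by positivity
    nlinarith

theorem fourth_moment_linForm (hX : Measurable X) (hX0 : ∫ s, X s ∂ρ = 0)
    (hX2 : ∫ s, X s ^ 2 ∂ρ = 1) (hX4 : Integrable (fun s => X s ^ 4) ρ) {b : ℝ}
    (hb : ∫ s, X s ^ 4 ∂ρ = b) (c : ι → ℝ) :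
    Integrable (fun x : ι → S => linForm X c x ^ 4) (Measure.pi fun _ => ρ) ∧
    ∫ x : ι → S, linForm X c x ^ 4 ∂(Measure.pi fun _ => ρ) ≤ (4 * b * ∑ j, c j ^ 2) ^ 2 :=
  fourth_moment_sum hX hX0 hX2 hX4 hb c Finset.univ

/-- Adding index `k` adds `X_k` times twice a linear form in the earlier variables, whose fourth
moment is already controlled. The factor `32 * b ^ 2` is chosen so that the cross term `8 A B`
closes the induction. -/
theorem fourth_moment_biForm (hX : Measurable X) (hX0 : ∫ s, X s ∂ρ = 0)
    (hX2 : ∫ s, X s ^ 2 ∂ρ = 1) (hX4 : Integrable (fun s => X s ^ 4) ρ) {b : ℝ}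
    (hb : ∫ s, X s ^ 4 ∂ρ = b) {a : ι → ι → ℝ} (ha : ∀ i j, a i j = a j i) (ha0 : ∀ i, a i i = 0) :
    Integrable (fun x : ι → S => biForm X a x ^ 4) (Measure.pi fun _ => ρ) ∧
    ∫ x : ι → S, biForm X a x ^ 4 ∂(Measure.pi fun _ => ρ) ≤
      (32 * b ^ 2 * ∑ i, ∑ j, a i j ^ 2) ^ 2 := by
  have hb1 : 1 ≤ b := hb ▸ one_le_fourth_moment hX hX2 hX4
  suffices h : ∀ T : Finset ι,
      Integrable (fun x : ι → S => (∑ i ∈ T, ∑ j ∈ T, a i j * X (x i) * X (x j)) ^ 4)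
        (Measure.pi fun _ => ρ) ∧
      ∫ x : ι → S, (∑ i ∈ T, ∑ j ∈ T, a i j * X (x i) * X (x j)) ^ 4 ∂(Measure.pi fun _ => ρ) ≤
        (32 * b ^ 2 * ∑ i ∈ T, ∑ j ∈ T, a i j ^ 2) ^ 2 from h Finset.univ
  intro T
  induction T using Finset.induction_on with
  | empty => simp
  | insert k T hk ih =>
    have hw : 0 ≤ ∑ i ∈ T, ∑ j ∈ T, a i j ^ 2 :=
      Finset.sum_nonneg fun i _ => Finset.sum_nonneg fun j _ => sq_nonneg _
    have hl : 0 ≤ ∑ j ∈ T, a k j ^ 2 := Finset.sum_nonneg fun j _ => sq_nonneg _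
    have hmx : ∀ j, Measurable fun x : ι → S => X (x j) := fun j =>
      hX.comp (measurable_pi_apply j)
    have hm : Measurable fun x : ι → S => ∑ i ∈ T, ∑ j ∈ T, a i j * X (x i) * X (x j) :=
      Finset.measurable_sum _ fun i _ => Finset.measurable_sum _ fun j _ =>
        ((hmx i).const_mul _).mul (hmx j)
    have hml : Measurable fun x : ι → S => 2 * ∑ j ∈ T, a k j * X (x j) :=
      (Finset.measurable_sum _ fun j _ => (hmx j).const_mul _).const_mul _
    have hupd : ∀ (x : ι → S) (s : S), ∀ j ∈ T, Function.update x k s j = x j := fun x s j hj =>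
      Function.update_of_ne (ne_of_mem_of_not_mem hj hk) _ _
    have hfree : FreeOf k fun x : ι → S => ∑ i ∈ T, ∑ j ∈ T, a i j * X (x i) * X (x j) :=
      fun x s => Finset.sum_congr rfl fun i hi => Finset.sum_congr rfl fun j hj => by
        rw [hupd x s i hi, hupd x s j hj]
    have hfreel : FreeOf k fun x : ι → S => 2 * ∑ j ∈ T, a k j * X (x j) := fun x s => by
      simp only
      congr 1
      exact Finset.sum_congr rfl fun j hj => by rw [hupd x s j hj]
    obtain ⟨l1, l2⟩ := fourth_moment_sum (ρ := ρ) hX hX0 hX2 hX4 hb (a k) T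
    have := fourth_moment_step (ρ := ρ) (i := k) (q := fun x => 2 * ∑ j ∈ T, a k j * X (x j))
      (A := 32 * b ^ 2 * ∑ i ∈ T, ∑ j ∈ T, a i j ^ 2)
      (B := 16 * b * ∑ j ∈ T, a k j ^ 2) hX hX0 hX2 hX4 hb
      hm hml hfree hfreel ih.1 (by simp only [mul_pow]; exact l1.const_mul _)
      (by positivity) (by positivity) ih.2 (by
        simp only [mul_pow]
        rw [integral_const_mul]
        nlinarith)
    have e : ∀ x : ι → S, ∑ i ∈ insert k T, ∑ j ∈ insert k T, a i j * X (x i) * X (x j) =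
        (∑ i ∈ T, ∑ j ∈ T, a i j * X (x i) * X (x j)) +
          X (x k) * (2 * ∑ j ∈ T, a k j * X (x j)) := fun x =>
      sum_insert_quadratic ha ha0 hk fun j => X (x j)
    have e2 : ∑ i ∈ insert k T, ∑ j ∈ insert k T, a i j ^ 2 =
        (∑ i ∈ T, ∑ j ∈ T, a i j ^ 2) + 2 * ∑ j ∈ T, a k j ^ 2 := by
      simp only [Finset.sum_insert hk, Finset.sum_add_distrib, ha0]
      have h1 : ∑ i ∈ T, a i k ^ 2 = ∑ i ∈ T, a k i ^ 2 :=
        Finset.sum_congr rfl fun i _ => by rw [ha i k]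
      rw [h1]; ring
    simp only [e]
    refine ⟨this.1, this.2.trans ?_⟩
    rw [e2]
    set w := ∑ i ∈ T, ∑ j ∈ T, a i j ^ 2
    set l := ∑ j ∈ T, a k j ^ 2
    have h1 : b ^ 3 * (w * l) ≤ b ^ 4 * (w * l) :=
      mul_le_mul_of_nonneg_right (pow_le_pow_right₀ hb1 (by norm_num)) (by positivity)
    have h2 : b ^ 3 * l ^ 2 ≤ b ^ 4 * l ^ 2 :=
      mul_le_mul_of_nonneg_right (pow_le_pow_right₀ hb1 (by norm_num)) (by positivity)
    have h3 : 0 ≤ b ^ 4 * l ^ 2 := by positivity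
    nlinarith

end Pi

/-! ### Second moments of sums of centred weights times functions of linear forms. -/

section Update

variable {ι S : Type*} [Fintype ι] [DecidableEq ι]

theorem linForm_eq_update_add (X : S → ℝ) (c : ι → ℝ) (j : ι) (x : ι → S) :
    linForm X c x = linForm X (Function.update c j 0) x + c j * X (x j) := by
  unfold linForm
  rw [← Finset.add_sum_erase _ _ (Finset.mem_univ j),
    ← Finset.add_sum_erase (a := j) _ (fun k => Function.update c j 0 k * X (x k))
      (Finset.mem_univ j)]
  have : ∑ k ∈ Finset.univ.erase j, Function.update c j 0 k * X (x k) =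
      ∑ k ∈ Finset.univ.erase j, c k * X (x k) :=
    Finset.sum_congr rfl fun k hk => by rw [Function.update_of_ne (Finset.ne_of_mem_erase hk)]
  rw [this]
  simp

theorem sum_update_sq_le (c : ι → ℝ) (j : ι) :
    ∑ k, Function.update c j 0 k ^ 2 ≤ ∑ k, c k ^ 2 :=
  Finset.sum_le_sum fun k _ => by
    by_cases hk : k = j
    · subst hk; simp [sq_nonneg]
    · rw [Function.update_of_ne hk]

end Update

section Weighted

variable {ι S : Type*} [Fintype ι] [DecidableEq ι] [MeasurableSpace S] {ρ : Measure S}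
  [IsProbabilityMeasure ρ] {X p g : S → ℝ} {b m : ℝ}

/-- As `c i = 0`, the weight at `i` is independent of the linear form, so the second moment is at
most `4 m (2 (4 m t)² + 2 t²)`. -/
theorem weighted_term_sq (hX : Measurable X) (hX0 : ∫ s, X s ∂ρ = 0) (hX2 : ∫ s, X s ^ 2 ∂ρ = 1)
    (hX4 : Integrable (fun s => X s ^ 4) ρ) (hb : ∫ s, X s ^ 4 ∂ρ = b) (hbm : b ≤ m)
    (hp : Measurable p) (hpi : Integrable (fun s => p s ^ 2) ρ) (hm : ∫ s, p s ^ 2 ∂ρ = m)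
    (hg : Measurable g) (hgp : ∀ s, |g s| ≤ 2 * p s)
    {i : ι} {c : ι → ℝ} (hci : c i = 0) {t : ℝ} (hct : ∑ j, c j ^ 2 ≤ t)
    {φ : ℝ → ℝ} (hφ : Measurable φ) (hφt : ∀ u, |φ u| ≤ u ^ 2 + t) :
    Integrable (fun x : ι → S => (g (x i) * φ (linForm X c x)) ^ 2) (Measure.pi fun _ => ρ) ∧
    ∫ x : ι → S, (g (x i) * φ (linForm X c x)) ^ 2 ∂(Measure.pi fun _ => ρ) ≤
      136 * m ^ 3 * t ^ 2 := by
  have hb1 : 1 ≤ b := hb ▸ one_le_fourth_moment hX hX2 hX4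
  have hs : 0 ≤ ∑ j, c j ^ 2 := Finset.sum_nonneg fun j _ => sq_nonneg _
  have ht : 0 ≤ t := hs.trans hct
  obtain ⟨l1, l2⟩ := fourth_moment_linForm (ρ := ρ) hX hX0 hX2 hX4 hb c
  have hL := measurable_linForm hX c
  have mK : Measurable fun x : ι → S => 2 * linForm X c x ^ 4 + 2 * t ^ 2 := by fun_prop
  have fK : FreeOf i fun x : ι → S => 2 * linForm X c x ^ 4 + 2 * t ^ 2 := fun x s => by
    simp only [freeOf_linForm hci x s]
  have iK : Integrable (fun x : ι → S => 2 * linForm X c x ^ 4 + 2 * t ^ 2)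
    (Measure.pi fun _ => ρ) := (l1.const_mul 2).add (integrable_const _)
  have mp : Measurable fun s => 4 * p s ^ 2 := by fun_prop
  have iD := integrable_mul_of_freeOf mp mK fK (hpi.const_mul 4) iK
  have ipt : ∀ x : ι → S, (g (x i) * φ (linForm X c x)) ^ 2 ≤
      4 * p (x i) ^ 2 * (2 * linForm X c x ^ 4 + 2 * t ^ 2) := fun x => by
    have h1 : g (x i) ^ 2 ≤ (2 * p (x i)) ^ 2 := sq_le_sq.2 ((hgp _).trans (le_abs_self _))
    have h2 : φ (linForm X c x) ^ 2 ≤ (linForm X c x ^ 2 + t) ^ 2 :=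
      sq_le_sq.2 ((hφt _).trans (le_abs_self _))
    have h3 : (linForm X c x ^ 2 + t) ^ 2 ≤ 2 * linForm X c x ^ 4 + 2 * t ^ 2 := by
      nlinarith [sq_nonneg (linForm X c x ^ 2 - t)]
    rw [mul_pow]
    calc _ ≤ (2 * p (x i)) ^ 2 * (2 * linForm X c x ^ 4 + 2 * t ^ 2) :=
          mul_le_mul h1 (h2.trans h3) (sq_nonneg _) (sq_nonneg _)
      _ = _ := by ring
  refine ⟨iD.mono' ?_ (.of_forall fun x => ?_), ?_⟩
  · exact (((hg.comp (measurable_pi_apply i)).mul (hφ.comp hL)).pow_const 2).aestronglyMeasurable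
  · rw [Real.norm_of_nonneg (sq_nonneg _)]; exact ipt x
  refine (integral_mono_of_nonneg (.of_forall fun x => sq_nonneg _) iD (.of_forall ipt)).trans ?_
  rw [integral_mul_of_freeOf mp mK fK, integral_const_mul, hm,
    integral_add (l1.const_mul 2) (integrable_const _), integral_const_mul, integral_const]
  simp only [probReal_univ, smul_eq_mul, one_mul]
  have h1 : (4 * b * ∑ j, c j ^ 2) ^ 2 ≤ (4 * m * t) ^ 2 := by
    have : 4 * b * ∑ j, c j ^ 2 ≤ 4 * m * t := by
      have := mul_le_mul hbm hct hs (by linarith)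
      linarith
    exact pow_le_pow_left₀ (by positivity) this 2
  have hm1 : 1 ≤ m := hb1.trans hbm
  have h2 : m * t ^ 2 ≤ m ^ 3 * t ^ 2 :=
    mul_le_mul_of_nonneg_right (by nlinarith [sq_nonneg m]) (sq_nonneg _)
  have h3 := mul_le_mul_of_nonneg_left (l2.trans h1) (by linarith : 0 ≤ m)
  nlinarith

/-- The two terms are dependent only because `x j` enters the first linear form and `x i` the
second. Subtracting the versions with these variables removed costs nothing, since the weights are
centred; each difference is then of order `|c j|`, so their product gains `c j ^ 2`. -/
theorem weighted_cross_term (hX : Measurable X) (hX0 : ∫ s, X s ∂ρ = 0)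
    (hX2 : ∫ s, X s ^ 2 ∂ρ = 1)
    (hX4 : Integrable (fun s => X s ^ 4) ρ) (hb : ∫ s, X s ^ 4 ∂ρ = b) (hbm : b ≤ m)
    (hp : Measurable p) (hpi : Integrable (fun s => p s ^ 2) ρ) (hm : ∫ s, p s ^ 2 ∂ρ = m)
    (hXp : ∀ s, |X s| ≤ p s) (hXp2 : ∀ s, X s ^ 2 ≤ p s)
    (hg : Measurable g) (hgp : ∀ s, |g s| ≤ 2 * p s) (hg0 : ∫ s, g s ∂ρ = 0)
    {i j : ι} (hij : i ≠ j) {c d : ι → ℝ} (hci : c i = 0) (hdj : d j = 0) (hcd : d i = c j)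
    {φ ψ : ℝ → ℝ} (hφ : Measurable φ) (hφt : ∀ u, |φ u| ≤ u ^ 2 + ∑ k, c k ^ 2)
    (hφ' : ∀ u v, |φ u - φ v| ≤ |u - v| * (|u| + |v|))
    (hψ : Measurable ψ) (hψt : ∀ u, |ψ u| ≤ u ^ 2 + ∑ k, d k ^ 2)
    (hψ' : ∀ u v, |ψ u - ψ v| ≤ |u - v| * (|u| + |v|)) :
    ∫ x : ι → S, (g (x i) * φ (linForm X c x)) * (g (x j) * ψ (linForm X d x))
      ∂(Measure.pi fun _ => ρ) ≤ 68 * m ^ 3 * (c j ^ 2 * (∑ k, c k ^ 2 + ∑ k, d k ^ 2)) := by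
  set P : Measure (ι → S) := Measure.pi fun _ => ρ
  have hb1 : 1 ≤ b := hb ▸ one_le_fourth_moment hX hX2 hX4
  have hm1 : 1 ≤ m := hb1.trans hbm
  set c' := Function.update c j 0 with hc'
  set d' := Function.update d i 0 with hd'
  have hc'i : c' i = 0 := by rw [hc', Function.update_of_ne hij, hci]
  have hc'j : c' j = 0 := by simp [hc']
  have hd'i : d' i = 0 := by simp [hd']
  have hd'j : d' j = 0 := by rw [hd', Function.update_of_ne hij.symm, hdj]
  have mL := fun c : ι → ℝ => measurable_linForm (S := S) hX c
  have mF := fun c : ι → ℝ => hφ.comp (mL c)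
  have mG := fun c : ι → ℝ => hψ.comp (mL c)
  have mg := fun i : ι => hg.comp (measurable_pi_apply (X := fun _ : ι => S) i)
  have F1 := (weighted_term_sq hX hX0 hX2 hX4 hb hbm hp hpi hm hg hgp hci le_rfl hφ hφt).1
  have F2 := (weighted_term_sq hX hX0 hX2 hX4 hb hbm hp hpi hm hg hgp hc'i
    (sum_update_sq_le c j) hφ hφt).1
  have G1 := (weighted_term_sq hX hX0 hX2 hX4 hb hbm hp hpi hm hg hgp hdj le_rfl hψ hψt).1
  have G2 := (weighted_term_sq hX hX0 hX2 hX4 hb hbm hp hpi hm hg hgp hd'j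
    (sum_update_sq_le d i) hψ hψt).1
  have mgF := fun c : ι → ℝ => (mg i).mul (mF c)
  have mgG := fun c : ι → ℝ => (mg j).mul (mG c)
  have I11 := integrable_mul_of_sq (mgF c) (mgG d) F1 G1
  have I12 := integrable_mul_of_sq (mgF c) (mgG d') F1 G2
  have I21 := integrable_mul_of_sq (mgF c') (mgG d) F2 G1
  have I22 := integrable_mul_of_sq (mgF c') (mgG d') F2 G2
  have hupdj : ∀ (x : ι → S) s, Function.update x j s i = x i := fun x s =>
    Function.update_of_ne hij _ _
  have hupdi : ∀ (x : ι → S) s, Function.update x i s j = x j := fun x s =>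
    Function.update_of_ne hij.symm _ _
  have Z2 : ∀ e : ι → ℝ, e j = 0 → ∫ x : ι → S, (g (x i) * φ (linForm X c' x)) *
      (g (x j) * ψ (linForm X e x)) ∂P = 0 := by
    intro e he
    have := integral_mul_of_freeOf (ρ := ρ) (i := j) (u := g)
      (F := fun x => g (x i) * φ (linForm X c' x) * ψ (linForm X e x)) hg
      ((mgF c').mul (mG e)) (fun x s => by
        simp only [freeOf_linForm hc'j x s, freeOf_linForm he x s, hupdj])
    rw [hg0, zero_mul] at this
    rw [← this]; congr 1; funext x; ring
  have Z1 : ∫ x : ι → S, (g (x i) * φ (linForm X c x)) *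
      (g (x j) * ψ (linForm X d' x)) ∂P = 0 := by
    have := integral_mul_of_freeOf (ρ := ρ) (i := i) (u := g)
      (F := fun x => φ (linForm X c x) * (g (x j) * ψ (linForm X d' x))) hg
      ((mF c).mul (mgG d')) (fun x s => by
        simp only [freeOf_linForm hci x s, freeOf_linForm hd'i x s, hupdi])
    rw [hg0, zero_mul] at this
    rw [← this]; congr 1; funext x; ring
  -- Of the four products in the double difference only the original has a possibly nonzero mean:
  -- the others contain a centred weight at `i` or `j` independent of all remaining factors.
  have e1 : ∫ x : ι → S, (g (x i) * φ (linForm X c x)) * (g (x j) * ψ (linForm X d x)) ∂P =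
      ∫ x : ι → S, (g (x i) * (φ (linForm X c x) - φ (linForm X c' x))) *
        (g (x j) * (ψ (linForm X d x) - ψ (linForm X d' x))) ∂P := by
    have h := integral_sub' (I11.sub I12) (I21.sub I22)
    rw [integral_sub' I11 I12, integral_sub' I21 I22] at h
    have z22 := Z2 d' hd'j
    have z21 := Z2 d hdj
    simp only [Function.comp, Pi.mul_apply] at h z22 z21
    rw [z22, z21, Z1] at h
    simp only [sub_zero] at h
    rw [← h]; congr 1; funext x
    simp only [Pi.sub_apply]; ring
  rw [e1]
  have hφd : ∀ x : ι → S, |φ (linForm X c x) - φ (linForm X c' x)| ≤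
      |c j| * (p (x j) * (2 * |linForm X c' x| + |c j|)) := by
    intro x
    have h := hφ' (linForm X c x) (linForm X c' x)
    rw [linForm_eq_update_add X c j x, ← hc', add_sub_cancel_left, abs_mul] at h
    rw [linForm_eq_update_add X c j x, ← hc']
    refine h.trans ?_
    rw [mul_assoc]
    refine mul_le_mul_of_nonneg_left ?_ (abs_nonneg _)
    have h2 := abs_add_le (linForm X c' x) (c j * X (x j))
    rw [abs_mul] at h2
    have h3 := mul_le_mul_of_nonneg_left h2 (abs_nonneg (X (x j)))
    have h4 := mul_le_mul_of_nonneg_right (hXp (x j)) (abs_nonneg (linForm X c' x))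
    have h5 := mul_le_mul_of_nonneg_right (hXp2 (x j)) (abs_nonneg (c j))
    rw [← sq_abs] at h5
    linarith
  have hψd : ∀ x : ι → S, |ψ (linForm X d x) - ψ (linForm X d' x)| ≤
      |c j| * (p (x i) * (2 * |linForm X d' x| + |c j|)) := by
    intro x
    have h := hψ' (linForm X d x) (linForm X d' x)
    rw [linForm_eq_update_add X d i x, ← hd', add_sub_cancel_left, abs_mul, hcd] at h
    rw [linForm_eq_update_add X d i x, ← hd', hcd]
    refine h.trans ?_
    rw [mul_assoc]
    refine mul_le_mul_of_nonneg_left ?_ (abs_nonneg _)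
    have h2 := abs_add_le (linForm X d' x) (c j * X (x i))
    rw [abs_mul] at h2
    have h3 := mul_le_mul_of_nonneg_left h2 (abs_nonneg (X (x i)))
    have h4 := mul_le_mul_of_nonneg_right (hXp (x i)) (abs_nonneg (linForm X d' x))
    have h5 := mul_le_mul_of_nonneg_right (hXp2 (x i)) (abs_nonneg (c j))
    rw [← sq_abs] at h5
    linarith
  set K : (ι → S) → ℝ := fun x => 4 * linForm X c' x ^ 2 + 4 * linForm X d' x ^ 2 + 2 * c j ^ 2
    with hK
  have hp0 : ∀ s, 0 ≤ p s := fun s => (abs_nonneg _).trans (hXp s)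
  have ipt : ∀ x : ι → S, (g (x i) * (φ (linForm X c x) - φ (linForm X c' x))) *
        (g (x j) * (ψ (linForm X d x) - ψ (linForm X d' x))) ≤
      4 * c j ^ 2 * (p (x i) ^ 2 * (p (x j) ^ 2 * K x)) := by
    intro x
    refine (le_abs_self _).trans ?_
    rw [abs_mul, abs_mul, abs_mul]
    have pi0 := hp0 (x i)
    have pj0 := hp0 (x j)
    have h1 := mul_le_mul (hgp (x i)) (hφd x) (abs_nonneg _) (by positivity)
    have h2 := mul_le_mul (hgp (x j)) (hψd x) (abs_nonneg _) (by positivity)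
    refine (mul_le_mul h1 h2 (by positivity) (by positivity)).trans ?_
    have h3 : (2 * |linForm X c' x| + |c j|) * (2 * |linForm X d' x| + |c j|) ≤ K x := by
      rw [hK]
      simp only
      rw [← sq_abs (linForm X c' x), ← sq_abs (linForm X d' x), ← sq_abs (c j)]
      nlinarith [sq_nonneg (2 * |linForm X c' x| + |c j| - (2 * |linForm X d' x| + |c j|)),
        sq_nonneg (2 * |linForm X c' x| - |c j|), sq_nonneg (2 * |linForm X d' x| - |c j|)]
    have h4 : 0 ≤ 4 * |c j| ^ 2 * (p (x i) ^ 2 * p (x j) ^ 2) := by positivity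
    have h5 := mul_le_mul_of_nonneg_left h3 h4
    rw [← sq_abs (c j)]
    linarith
  have c2 := fourth_moment_linForm (ρ := ρ) hX hX0 hX2 hX4 hb c'
  have d2 := fourth_moment_linForm (ρ := ρ) hX hX0 hX2 hX4 hb d'
  have sc := sum_update_sq_le c j
  have sd := sum_update_sq_le d i
  have sc0 : 0 ≤ ∑ k, c' k ^ 2 := Finset.sum_nonneg fun j _ => sq_nonneg _
  have sd0 : 0 ≤ ∑ k, d' k ^ 2 := Finset.sum_nonneg fun j _ => sq_nonneg _
  obtain ⟨c3, c4⟩ := integral_sq_le_of_fourth (by positivity) (mL c') c2.1 c2.2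
  obtain ⟨d3, d4⟩ := integral_sq_le_of_fourth (by positivity) (mL d') d2.1 d2.2
  have mK : Measurable K := by
    have := mL c'
    have := mL d'
    fun_prop
  have iK : Integrable K P := ((c3.const_mul 4).add (d3.const_mul 4)).add (integrable_const _)
  have fKi : FreeOf i K := fun x s => by
    simp only [hK, freeOf_linForm hc'i x s, freeOf_linForm hd'i x s]
  have fKj : FreeOf j K := fun x s => by
    simp only [hK, freeOf_linForm hc'j x s, freeOf_linForm hd'j x s]
  have mp2 : Measurable fun s => p s ^ 2 := hp.pow_const 2
  have iKj := integrable_mul_of_freeOf mp2 mK fKj hpi iK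
  have mKj : Measurable fun x : ι → S => p (x j) ^ 2 * K x :=
    (mp2.comp (measurable_pi_apply j)).mul mK
  have fKij : FreeOf i fun x : ι → S => p (x j) ^ 2 * K x := fun x s => by
    simp only [fKi x s, hupdi]
  have iKij := integrable_mul_of_freeOf mp2 mKj fKij hpi iKj
  have iL : Integrable (fun x : ι → S => (g (x i) * (φ (linForm X c x) - φ (linForm X c' x))) *
        (g (x j) * (ψ (linForm X d x) - ψ (linForm X d' x)))) P := by
    refine ((I11.sub I12).sub (I21.sub I22)).congr (.of_forall fun x => ?_)
    simp only [Pi.sub_apply, Pi.mul_apply, Function.comp]; ring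
  refine (integral_mono iL (iKij.const_mul (4 * c j ^ 2)) ipt).trans ?_
  rw [integral_const_mul, integral_mul_of_freeOf mp2 mKj fKij,
    integral_mul_of_freeOf mp2 mK fKj, hm]
  -- The squares of the linear forms give `4 * 4 m`; the term `2 * c j ^ 2` gives the remaining `m`.
  have eK : ∫ x, K x ∂P ≤ 17 * m * (∑ k, c k ^ 2 + ∑ k, d k ^ 2) := by
    have : ∫ x, K x ∂P = _ :=
      integral_add' ((c3.const_mul 4).add (d3.const_mul 4)) (integrable_const (2 * c j ^ 2))
    rw [this, integral_add (c3.const_mul 4) (d3.const_mul 4), integral_const_mul,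
      integral_const_mul, integral_const]
    simp only [probReal_univ, smul_eq_mul, one_mul]
    have q1 : c j ^ 2 ≤ ∑ k, c k ^ 2 :=
      Finset.single_le_sum (f := fun k => c k ^ 2) (fun k _ => sq_nonneg _) (Finset.mem_univ j)
    have q2 : c j ^ 2 ≤ ∑ k, d k ^ 2 := hcd ▸
      Finset.single_le_sum (f := fun k => d k ^ 2) (fun k _ => sq_nonneg _) (Finset.mem_univ i)
    have q3 := mul_le_mul hbm sc sc0 (by linarith)
    have q4 := mul_le_mul hbm sd sd0 (by linarith)
    have q5 : 2 * c j ^ 2 ≤ m * (∑ k, c k ^ 2 + ∑ k, d k ^ 2) := by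
      have : 0 ≤ c j ^ 2 := sq_nonneg _
      nlinarith
    simp only [← hc', ← hd'] at q3 q4
    linarith
  have := mul_le_mul_of_nonneg_left eK (by positivity : 0 ≤ 4 * c j ^ 2 * m ^ 2)
  linarith

/-- The diagonal contributes the constant 136. In the off-diagonal sum, `∑_j a i j ^ 2` completes
the square of the row sum, and the two symmetric halves contribute `2 * 68`. -/
theorem weighted_sum_sq (hX : Measurable X) (hX0 : ∫ s, X s ∂ρ = 0)
    (hX2 : ∫ s, X s ^ 2 ∂ρ = 1)
    (hX4 : Integrable (fun s => X s ^ 4) ρ) (hb : ∫ s, X s ^ 4 ∂ρ = b) (hbm : b ≤ m)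
    (hp : Measurable p) (hpi : Integrable (fun s => p s ^ 2) ρ) (hm : ∫ s, p s ^ 2 ∂ρ = m)
    (hXp : ∀ s, |X s| ≤ p s) (hXp2 : ∀ s, X s ^ 2 ≤ p s)
    (hg : Measurable g) (hgp : ∀ s, |g s| ≤ 2 * p s) (hg0 : ∫ s, g s ∂ρ = 0)
    {a : ι → ι → ℝ} (ha : ∀ i j, a i j = a j i) (ha0 : ∀ i, a i i = 0)
    {φ : ι → ℝ → ℝ} (hφ : ∀ i, Measurable (φ i))
    (hφt : ∀ i u, |φ i u| ≤ u ^ 2 + ∑ k, a i k ^ 2)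
    (hφ' : ∀ i u v, |φ i u - φ i v| ≤ |u - v| * (|u| + |v|)) :
    Integrable (fun x : ι → S => (∑ i, g (x i) * φ i (linForm X (a i) x)) ^ 2)
      (Measure.pi fun _ => ρ) ∧
    ∫ x : ι → S, (∑ i, g (x i) * φ i (linForm X (a i) x)) ^ 2 ∂(Measure.pi fun _ => ρ) ≤
      272 * m ^ 3 * ∑ i, (∑ k, a i k ^ 2) ^ 2 := by
  have hb1 : 1 ≤ b := hb ▸ one_le_fourth_moment hX hX2 hX4
  have hm0 : 0 ≤ m := by linarith
  have hsq := fun i => weighted_term_sq hX hX0 hX2 hX4 hb hbm hp hpi hm hg hgp (ha0 i) le_rfl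
    (hφ i) (hφt i)
  have mT : ∀ i, Measurable fun x : ι → S => g (x i) * φ i (linForm X (a i) x) := fun i =>
    (hg.comp (measurable_pi_apply i)).mul ((hφ i).comp (measurable_linForm hX _))
  have iT := fun i j => integrable_mul_of_sq (mT i) (mT j) (hsq i).1 (hsq j).1
  have e : ∀ x : ι → S, (∑ i, g (x i) * φ i (linForm X (a i) x)) ^ 2 =
      ∑ i, ∑ j, (g (x i) * φ i (linForm X (a i) x)) * (g (x j) * φ j (linForm X (a j) x)) :=
    fun x => by rw [sq, Finset.sum_mul_sum]
  simp only [e]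
  refine ⟨integrable_finsetSum _ fun i _ => integrable_finsetSum _ fun j _ => iT i j, ?_⟩
  rw [integral_finsetSum _ fun i _ => integrable_finsetSum _ fun j _ => iT i j]
  simp only [integral_finsetSum _ fun j _ => iT _ j]
  have key : ∀ i j, ∫ x : ι → S, (g (x i) * φ i (linForm X (a i) x)) *
      (g (x j) * φ j (linForm X (a j) x)) ∂(Measure.pi fun _ => ρ) ≤
      (if i = j then 136 * m ^ 3 * (∑ k, a i k ^ 2) ^ 2 else 0) +
      68 * m ^ 3 * (a i j ^ 2 * (∑ k, a i k ^ 2) + a j i ^ 2 * ∑ k, a j k ^ 2) := by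
    intro i j
    by_cases hij : i = j
    · subst hij
      have := (hsq i).2
      simp only [sq (g _ * _)] at this
      simpa [ha0] using this
    · rw [if_neg hij, zero_add, ha j i, ← mul_add]
      exact weighted_cross_term hX hX0 hX2 hX4 hb hbm hp hpi hm hXp hXp2 hg hgp hg0 hij (ha0 i)
        (ha0 j) (ha j i) (hφ i) (hφt i) (hφ' i) (hφ j) (hφt j) (hφ' j)
  refine (Finset.sum_le_sum fun i _ => Finset.sum_le_sum fun j _ => key i j).trans (le_of_eq ?_)
  simp only [Finset.sum_add_distrib, Finset.sum_ite_eq, Finset.mem_univ, if_true,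
    ← Finset.mul_sum]
  have h1 : ∑ i, ∑ j, a j i ^ 2 * ∑ k, a j k ^ 2 = ∑ i, ∑ j, a i j ^ 2 * ∑ k, a i k ^ 2 :=
    Finset.sum_comm
  rw [h1]
  simp only [← Finset.sum_mul, ← sq]
  ring

end Weighted

/-! ### The exchangeable pair identity. -/

/-- The derivative of `steinSol z` (the left derivative at `z`). -/
noncomputable def steinDeriv (z w : ℝ) : ℝ := w * steinSol z w + steinStep z w + steinConst z

/-- The increasing function controlling the oscillation of `steinDeriv z`. -/
noncomputable def steinOsc (z w : ℝ) : ℝ := w * steinSol z w - steinStep z w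

theorem measurable_steinDeriv (z : ℝ) : Measurable (steinDeriv z) :=
  ((monotone_mul_steinSol z).measurable.add (antitone_steinStep z).measurable).add_const _

theorem measurable_steinOsc (z : ℝ) : Measurable (steinOsc z) :=
  (monotone_mul_steinSol z).measurable.sub (antitone_steinStep z).measurable

theorem exists_abs_steinDeriv_le (z : ℝ) : ∃ B, ∀ w, |steinDeriv z w| ≤ B := by
  refine ⟨1 + |z| * (millsRatio z + millsRatio (-z)) + 1 + |steinConst z|, fun w => ?_⟩
  exact (abs_add_le _ _).trans (add_le_add ((abs_add_le _ _).trans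
    (add_le_add (abs_mul_steinSol_le_const z w) (abs_steinStep_le_one z w))) le_rfl)

theorem exists_abs_steinOsc_le (z : ℝ) : ∃ B, ∀ w, |steinOsc z w| ≤ B := by
  refine ⟨1 + |z| * (millsRatio z + millsRatio (-z)) + 1, fun w => ?_⟩
  exact (abs_sub _ _).trans
    (add_le_add (abs_mul_steinSol_le_const z w) (abs_steinStep_le_one z w))

theorem abs_steinDeriv_le (z w : ℝ) : |steinDeriv z w| ≤ 12 / (1 + |z|) ^ 2 * (1 + w ^ 2) := by
  have h1 := abs_mul_steinSol_le z w
  have h2 := abs_steinStep_le z w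
  have h3 := abs_steinConst_le z w
  have h4 : 12 / (1 + |z|) ^ 2 * (1 + w ^ 2) = 3 * (4 * (1 + w ^ 2) / (1 + |z|) ^ 2) := by ring
  have h5 := (abs_add_le (w * steinSol z w + steinStep z w) (steinConst z))
  have h6 := abs_add_le (w * steinSol z w) (steinStep z w)
  rw [steinDeriv]
  linarith

theorem abs_steinOsc_le (z w : ℝ) : |steinOsc z w| ≤ 8 / (1 + |z|) ^ 2 * (1 + w ^ 2) := by
  have h1 := abs_mul_steinSol_le z w
  have h2 := abs_steinStep_le z w
  have h4 : 8 / (1 + |z|) ^ 2 * (1 + w ^ 2) = 2 * (4 * (1 + w ^ 2) / (1 + |z|) ^ 2) := by ring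
  have h6 := abs_sub (w * steinSol z w) (steinStep z w)
  rw [steinOsc]
  linarith

section Exchangeable

variable {Ω : Type*} [MeasurableSpace Ω] {P : Measure Ω} {W D : Ω → ℝ} {u : ℝ → ℝ}

theorem integrable_mul_comp_of_bdd (hW : Measurable W) (hu : Measurable u)
    (hb : ∃ B, ∀ w, |u w| ≤ B) (hD : Integrable D P) : Integrable (fun x => D x * u (W x)) P := by
  obtain ⟨B, hB⟩ := hb
  exact hD.mul_bdd (c := B) (hu.comp hW).aestronglyMeasurable (.of_forall fun x => hB _)

theorem exists_abs_steinSol_le (z : ℝ) : ∃ B, ∀ w, |steinSol z w| ≤ B :=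
  ⟨_, fun w => (abs_of_nonneg (steinSol_nonneg z w)).trans_le (steinSol_le z w)⟩

/-- Stein's method for an involution `σ` preserving `P`, with increment `D = W - W ∘ σ`. -/
theorem abs_stein_exchange_le [IsProbabilityMeasure P] {σ : Ω → Ω} (hσ : MeasurePreserving σ P P)
    (hW : Measurable W) (hD : Measurable D) (hWσ : ∀ x, W (σ x) = W x - D x)
    (hDσ : ∀ x, D (σ x) = -D x) (hD2 : Integrable (fun x => D x ^ 2) P) (z : ℝ) :
    |∫ x, D x ^ 2 * steinDeriv z (W x) ∂P - 2 * ∫ x, D x * steinSol z (W x) ∂P| ≤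
      ∫ x, D x * |D x| * steinOsc z (W x) ∂P := by
  have hD1 : Integrable D P := by
    have := integrable_mul_of_sq hD measurable_const hD2 (g := fun _ => 1) (integrable_const _)
    simpa using this
  have hDD : Integrable (fun x => D x * |D x|) P := by
    refine hD2.mono' (by fun_prop) (.of_forall fun x => ?_)
    rw [norm_mul, Real.norm_eq_abs, Real.norm_eq_abs, abs_abs, ← sq, sq_abs]
  have mk := measurable_steinDeriv z
  have mf := measurable_steinSol z
  have mh := measurable_steinOsc z
  have i1 := integrable_mul_comp_of_bdd hW mk (exists_abs_steinDeriv_le z) hD2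
  have i2 := integrable_mul_comp_of_bdd hW mf (exists_abs_steinSol_le z) hD1
  have i3 := integrable_mul_comp_of_bdd hW mh (exists_abs_steinOsc_le z) hDD
  have m1 : Measurable fun x => D x ^ 2 * steinDeriv z (W x) :=
    (hD.pow_const 2).mul (mk.comp hW)
  have m2 : Measurable fun x => D x * steinSol z (W x) := hD.mul (mf.comp hW)
  have m3 : Measurable fun x => D x * |D x| * steinOsc z (W x) :=
    (hD.mul (by fun_prop)).mul (mh.comp hW)
  have j1 := hσ.integrable_comp_of_integrable i1
  have j2 := hσ.integrable_comp_of_integrable i2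
  have j3 := hσ.integrable_comp_of_integrable i3
  have e1 := integral_comp_of_measurePreserving hσ m1
  have e2 := integral_comp_of_measurePreserving hσ m2
  have e3 := integral_comp_of_measurePreserving hσ m3
  have hI := (((i1.add j1).div_const 2).sub (i2.add j2))
  have hJ := (i3.add j3).div_const 2
  -- Averaging each integrand with its image under `σ` produces the trapezoidal expression: `D` is
  -- odd under `σ`, so `D f(W)` symmetrises to `D (f(W) - f(W ∘ σ))`.
  have hint : ∫ x, (((fun x => D x ^ 2 * steinDeriv z (W x)) +
      (fun x => D x ^ 2 * steinDeriv z (W x)) ∘ σ) x / 2 -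
      ((fun x => D x * steinSol z (W x)) + (fun x => D x * steinSol z (W x)) ∘ σ) x) ∂P =
      ∫ x, D x ^ 2 * steinDeriv z (W x) ∂P - 2 * ∫ x, D x * steinSol z (W x) ∂P := by
    rw [integral_sub ((i1.add j1).div_const 2) (i2.add j2), integral_div,
      integral_add' i1 j1, integral_add' i2 j2]
    simp only [Function.comp]
    rw [e1, e2]; ring
  have hint2 : ∫ x, (((fun x => D x * |D x| * steinOsc z (W x)) +
      (fun x => D x * |D x| * steinOsc z (W x)) ∘ σ) x / 2) ∂P =
      ∫ x, D x * |D x| * steinOsc z (W x) ∂P := by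
    rw [integral_div, integral_add' i3 j3]
    simp only [Function.comp]
    rw [e3]; ring
  rw [← hint, ← hint2]
  refine abs_integral_le_integral_abs.trans (integral_mono hI.abs hJ fun x => ?_)
  have h := abs_steinSol_trapezoid_le z (W x) (W (σ x))
  have hd : W x - W (σ x) = D x := by rw [hWσ]; ring
  rw [hd] at h
  simp only [Pi.add_apply, Function.comp, hDσ, abs_neg]
  simp only [steinDeriv, steinOsc]
  refine le_trans (le_of_eq ?_) (h.trans (le_of_eq ?_))
  · congr 1; ring
  · ring

end Exchangeable

theorem biForm_eq_sum_mul_linForm {ι S : Type*} [Fintype ι] (X : S → ℝ) (a : ι → ι → ℝ) (x : ι → S) :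
    biForm X a x = ∑ i, X (x i) * linForm X (a i) x := by
  simp only [biForm, linForm, Finset.mul_sum]
  exact Finset.sum_congr rfl fun i _ => Finset.sum_congr rfl fun j _ => by ring

section Update

variable {ι S : Type*} [Fintype ι] [DecidableEq ι]

theorem linForm_eq_sum_erase (X : S → ℝ) {c : ι → ℝ} {i : ι} (hc : c i = 0) (x : ι → S) :
    linForm X c x = ∑ j ∈ Finset.univ.erase i, c j * X (x j) := by
  rw [linForm, ← Finset.add_sum_erase _ _ (Finset.mem_univ i), hc]; simp

theorem biForm_eq_add (X : S → ℝ) {a : ι → ι → ℝ} (ha : ∀ i j, a i j = a j i)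
    (ha0 : ∀ i, a i i = 0) (i : ι) (x : ι → S) :
    biForm X a x = (∑ j ∈ Finset.univ.erase i, ∑ k ∈ Finset.univ.erase i,
      a j k * X (x j) * X (x k)) + X (x i) * (2 * linForm X (a i) x) := by
  rw [linForm_eq_sum_erase X (ha0 i), biForm, ← sum_insert_quadratic ha ha0
    (Finset.notMem_erase i Finset.univ) fun j => X (x j), Finset.insert_erase (Finset.mem_univ i)]

theorem biForm_update (X : S → ℝ) {a : ι → ι → ℝ} (ha : ∀ i j, a i j = a j i)
    (ha0 : ∀ i, a i i = 0) (i : ι) (x : ι → S) (s : S) :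
    biForm X a (Function.update x i s) =
      biForm X a x - 2 * (X (x i) - X s) * linForm X (a i) x := by
  have h : ∀ j ∈ Finset.univ.erase i, Function.update x i s j = x j := fun j hj =>
    Function.update_of_ne (Finset.ne_of_mem_erase hj) _ _
  rw [biForm_eq_add X ha ha0 i, biForm_eq_add X ha ha0 i x, freeOf_linForm (ha0 i) x s,
    Function.update_self]
  have : ∑ j ∈ Finset.univ.erase i, ∑ k ∈ Finset.univ.erase i,
      a j k * X (Function.update x i s j) * X (Function.update x i s k) =
      ∑ j ∈ Finset.univ.erase i, ∑ k ∈ Finset.univ.erase i, a j k * X (x j) * X (x k) :=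
    Finset.sum_congr rfl fun j hj => Finset.sum_congr rfl fun k hk => by rw [h j hj, h k hk]
  rw [this]; ring

end Update

/-- The copies are jointly independent of the original variables and have mean zero. -/
theorem integral_snd_mul_comp_fst {ι : Type*} [Fintype ι] {ν : Measure ℝ} [IsProbabilityMeasure ν]
    (hν : ∫ t, t ∂ν = 0) (i : ι) {G : (ι → ℝ) → ℝ}
    (hG : Measurable G) :
    ∫ x : ι → ℝ × ℝ, (x i).2 * G (fun j => (x j).1) ∂(Measure.pi fun _ => ν.prod ν) = 0 := by
  have h := integral_comp_of_measurePreserving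
    (measurePreserving_arrowProdEquivProdArrow ℝ ℝ ι (fun _ => ν) (fun _ => ν))
    (u := fun y => G y.1 * y.2 i)
    ((hG.comp measurable_fst).mul ((measurable_pi_apply i).comp measurable_snd))
  rw [integral_prod_mul G (fun y : ι → ℝ => y i),
    integral_comp_eval (u := fun t => t) measurable_id, hν, mul_zero] at h
  rw [← h]
  congr 1; funext x
  rw [mul_comm]; rfl

section Pairs

variable {ι : Type*} [Fintype ι] [DecidableEq ι] {ν : Measure ℝ} [IsProbabilityMeasure ν]

theorem measurePreserving_swap_coord (i : ι) :
    MeasurePreserving (fun x : ι → ℝ × ℝ => Function.update x i (x i).swap)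
      (Measure.pi fun _ => ν.prod ν) (Measure.pi fun _ => ν.prod ν) := by
  have h := measurePreserving_pi (fun _ : ι => ν.prod ν) (fun _ : ι => ν.prod ν)
    (f := fun j => if j = i then Prod.swap else id) (fun j => by
      by_cases hj : j = i
      · simp only [hj, if_true]; exact Measure.measurePreserving_swap
      · simp only [hj, if_false]; exact MeasurePreserving.id _)
  convert h using 1
  funext x j
  by_cases hj : j = i
  · subst hj; simp
  · simp [hj]

end Pairs

/-! ### Moments and centred weights of a pair. -/

section PairMoments

variable {ν : Measure ℝ} [IsProbabilityMeasure ν] {b : ℝ}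

/-- Weight dominating the square increments of a pair. -/
def pairWeight (s : ℝ × ℝ) : ℝ := 1 + s.1 ^ 2 + s.2 ^ 2

theorem measurable_pairWeight : Measurable pairWeight := by unfold pairWeight; fun_prop

theorem integral_fst_comp {u : ℝ → ℝ} (hu : Measurable u) :
    ∫ s, u s.1 ∂(ν.prod ν) = ∫ t, u t ∂ν :=
  integral_comp_of_measurePreserving measurePreserving_fst hu

theorem integral_snd_comp {u : ℝ → ℝ} (hu : Measurable u) :
    ∫ s, u s.2 ∂(ν.prod ν) = ∫ t, u t ∂ν :=
  integral_comp_of_measurePreserving measurePreserving_snd hu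

theorem integrable_fst_comp {u : ℝ → ℝ} (hu : Integrable u ν) :
    Integrable (fun s : ℝ × ℝ => u s.1) (ν.prod ν) :=
  measurePreserving_fst.integrable_comp_of_integrable hu

theorem integrable_snd_comp {u : ℝ → ℝ} (hu : Integrable u ν) :
    Integrable (fun s : ℝ × ℝ => u s.2) (ν.prod ν) :=
  measurePreserving_snd.integrable_comp_of_integrable hu

theorem pairWeight_sq_le (s : ℝ × ℝ) : pairWeight s ^ 2 ≤ 3 + 3 * s.1 ^ 4 + 3 * s.2 ^ 4 := by
  unfold pairWeight
  nlinarith [sq_nonneg (s.1 ^ 2 - 1), sq_nonneg (s.2 ^ 2 - 1), sq_nonneg (s.1 ^ 2 - s.2 ^ 2)]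

theorem integrable_pairWeight_sq (h4 : Integrable (fun t => t ^ 4) ν) :
    Integrable (fun s => pairWeight s ^ 2) (ν.prod ν) := by
  refine (((integrable_const (3 : ℝ)).add ((integrable_fst_comp h4).const_mul 3)).add
    ((integrable_snd_comp h4).const_mul 3)).mono'
    (measurable_pairWeight.pow_const 2).aestronglyMeasurable (.of_forall fun s => ?_)
  rw [Real.norm_of_nonneg (sq_nonneg _)]
  exact pairWeight_sq_le s

theorem integral_pairWeight_sq_le (h4 : Integrable (fun t => t ^ 4) ν) (hb : ∫ t, t ^ 4 ∂ν = b) :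
    ∫ s, pairWeight s ^ 2 ∂(ν.prod ν) ≤ 3 + 6 * b := by
  have i1 := (integrable_fst_comp h4).const_mul 3
  have i2 := (integrable_snd_comp h4).const_mul 3
  have i0 : Integrable (fun _ : ℝ × ℝ => (3 : ℝ)) (ν.prod ν) := integrable_const _
  refine (integral_mono (integrable_pairWeight_sq h4) ((i0.add i1).add i2)
    pairWeight_sq_le).trans (le_of_eq ?_)
  rw [integral_add' (i0.add i1) i2, integral_add' i0 i1, integral_const_mul, integral_const_mul,
    integral_fst_comp (u := fun t => t ^ 4) (by fun_prop),
    integral_snd_comp (u := fun t => t ^ 4) (by fun_prop), hb, integral_const]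
  simp only [probReal_univ, smul_eq_mul]
  ring

theorem le_integral_pairWeight_sq (h4 : Integrable (fun t => t ^ 4) ν)
    (hb : ∫ t, t ^ 4 ∂ν = b) : b ≤ ∫ s, pairWeight s ^ 2 ∂(ν.prod ν) := by
  rw [← hb, ← integral_fst_comp (u := fun t => t ^ 4) (by fun_prop)]
  refine integral_mono (integrable_fst_comp h4) (integrable_pairWeight_sq h4) fun s => ?_
  unfold pairWeight
  nlinarith [sq_nonneg s.1, sq_nonneg s.2, mul_nonneg (sq_nonneg s.1) (sq_nonneg s.2)]

theorem integral_sq_sub_one (h4 : Integrable (fun t => t ^ 4) ν) (h2 : ∫ t, t ^ 2 ∂ν = 1) :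
    ∫ s : ℝ × ℝ, (s.1 ^ 2 - 1) ∂(ν.prod ν) = 0 := by
  have i2 : Integrable (fun t => t ^ 2) ν :=
    (integral_sq_le_of_fourth (Real.sqrt_nonneg (∫ t, t ^ 4 ∂ν)) measurable_id h4
      (Real.sq_sqrt (integral_nonneg fun t => by positivity)).ge).1
  rw [integral_fst_comp (u := fun t => t ^ 2 - 1) (by fun_prop),
    integral_sub i2 (integrable_const _), h2]
  simp

theorem integral_sq_diff_sub_two (h4 : Integrable (fun t => t ^ 4) ν) (h1 : ∫ t, t ∂ν = 0)
    (h2 : ∫ t, t ^ 2 ∂ν = 1) :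
    ∫ s : ℝ × ℝ, ((s.1 - s.2) ^ 2 - 2) ∂(ν.prod ν) = 0 := by
  have i2 : Integrable (fun t => t ^ 2) ν :=
    (integral_sq_le_of_fourth (Real.sqrt_nonneg (∫ t, t ^ 4 ∂ν)) measurable_id h4
      (Real.sq_sqrt (integral_nonneg fun t => by positivity)).ge).1
  have i3 := integrable_fst_comp i2
  have i4 := integrable_snd_comp i2
  have i5 := (integrable_mul_of_sq measurable_fst measurable_snd i3 i4).const_mul 2
  have e : ∀ s : ℝ × ℝ, (s.1 - s.2) ^ 2 - 2 =
      (((fun s : ℝ × ℝ => s.1 ^ 2) + fun s : ℝ × ℝ => s.2 ^ 2) - fun s : ℝ × ℝ => 2 * (s.1 * s.2)) s - 2 := by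
    intro s; simp only [Pi.sub_apply, Pi.add_apply]; ring
  simp only [e]
  rw [integral_sub ((i3.add i4).sub i5) (integrable_const _), integral_sub' (i3.add i4) i5,
    integral_add' i3 i4, integral_const_mul, integral_prod_mul (fun t : ℝ => t) (fun t : ℝ => t),
    integral_fst_comp (u := fun t => t ^ 2) (by fun_prop),
    integral_snd_comp (u := fun t => t ^ 2) (by fun_prop), h1, h2]
  simp; norm_num

theorem integral_diff_mul_abs :
    ∫ s : ℝ × ℝ, (s.1 - s.2) * |s.1 - s.2| ∂(ν.prod ν) = 0 := by
  have h := integral_comp_of_measurePreserving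
    (Measure.measurePreserving_swap (μ := ν) (ν := ν))
    (u := fun s => (s.1 - s.2) * |s.1 - s.2|) (by fun_prop)
  have e : ∀ s : ℝ × ℝ, (s.swap.1 - s.swap.2) * |s.swap.1 - s.swap.2| =
      -((s.1 - s.2) * |s.1 - s.2|) := by
    intro s
    rw [Prod.fst_swap, Prod.snd_swap, abs_sub_comm]; ring
  simp only [e, integral_neg] at h
  linarith

theorem abs_sq_sub_one_le (s : ℝ × ℝ) : |s.1 ^ 2 - 1| ≤ 2 * pairWeight s := by
  unfold pairWeight
  rw [abs_le]; constructor <;> nlinarith [sq_nonneg s.1, sq_nonneg s.2]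

theorem abs_sq_diff_sub_two_le (s : ℝ × ℝ) : |(s.1 - s.2) ^ 2 - 2| ≤ 2 * pairWeight s := by
  unfold pairWeight
  rw [abs_le]; constructor <;> nlinarith [sq_nonneg s.1, sq_nonneg s.2, sq_nonneg (s.1 + s.2),
    sq_nonneg (s.1 - s.2)]

theorem abs_diff_mul_abs_le (s : ℝ × ℝ) : |(s.1 - s.2) * (|s.1 - s.2|)| ≤ 2 * pairWeight s := by
  rw [abs_mul, abs_abs, ← sq, sq_abs]
  unfold pairWeight
  nlinarith [sq_nonneg (s.1 + s.2)]

theorem abs_mul_abs_sub_le (u v : ℝ) : |u * |u| - v * (|v|)| ≤ |u - v| * (|u| + |v|) := by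
  rcases le_total 0 u with hu | hu <;> rcases le_total 0 v with hv | hv
  all_goals
    first
    | rw [abs_of_nonneg hu] | rw [abs_of_nonpos hu]
    first
    | rw [abs_of_nonneg hv] | rw [abs_of_nonpos hv]
    rcases le_total 0 (u - v) with h | h
    all_goals
      first
      | rw [abs_of_nonneg h] | rw [abs_of_nonpos h]
      rw [abs_le]
      constructor <;> nlinarith

end PairMoments

/-! ### Stein's method for the quadratic form. -/

section Main

variable {ι : Type*} [Fintype ι] [DecidableEq ι] {ν : Measure ℝ} [IsProbabilityMeasure ν]
  {b : ℝ} {a : ι → ι → ℝ}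

theorem integrable_diff_mul_linForm_sq (h1 : ∫ t, t ∂ν = 0) (h2 : ∫ t, t ^ 2 ∂ν = 1)
    (h4 : Integrable (fun t => t ^ 4) ν) {c : ι → ℝ} {i : ι} (hc : c i = 0) {u : ℝ × ℝ → ℝ}
    (hu : Measurable u) (hup : ∀ s, u s ^ 2 ≤ 2 * pairWeight s ^ 2) :
    Integrable (fun x : ι → ℝ × ℝ => (u (x i) * linForm Prod.fst c x) ^ 2)
      (Measure.pi fun _ => ν.prod ν) := by
  have l := fourth_moment_linForm (ρ := ν.prod ν) measurable_fst
    ((integral_fst_comp (u := fun t => t) (by fun_prop)).trans h1)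
    ((integral_fst_comp (u := fun t => t ^ 2) (by fun_prop)).trans h2) (integrable_fst_comp h4)
    (integral_fst_comp (u := fun t => t ^ 4) (by fun_prop)) c
  have hb : 0 ≤ ∫ t, t ^ 4 ∂ν := integral_nonneg fun t => by positivity
  have l2 := (integral_sq_le_of_fourth (by positivity) (measurable_linForm measurable_fst c)
    l.1 l.2).1
  have iu : Integrable (fun s => u s ^ 2) (ν.prod ν) := by
    refine ((integrable_pairWeight_sq h4).const_mul 2).mono' (hu.pow_const 2).aestronglyMeasurable
      (.of_forall fun s => ?_)
    rw [Real.norm_of_nonneg (sq_nonneg _)]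
    exact hup s
  have := integrable_mul_of_freeOf (i := i) (hu.pow_const 2)
    ((measurable_linForm measurable_fst c).pow_const 2)
    (fun x s => by simp only [freeOf_linForm hc x s]) iu l2
  refine this.congr (.of_forall fun x => ?_)
  simp only; ring

/-- The exchange inequality for the swap at `i`, with increment `2 (x - x') L_i`, divided by 4. -/
theorem abs_stein_biForm_coord_le (h1 : ∫ t, t ∂ν = 0) (h2 : ∫ t, t ^ 2 ∂ν = 1)
    (h4 : Integrable (fun t => t ^ 4) ν) (ha : ∀ i j, a i j = a j i) (ha0 : ∀ i, a i i = 0)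
    (z : ℝ) (i : ι) :
    |∫ x : ι → ℝ × ℝ, (((x i).1 - (x i).2) ^ 2 * linForm Prod.fst (a i) x ^ 2) *
        steinDeriv z (biForm Prod.fst a x) ∂(Measure.pi fun _ => ν.prod ν) -
      ∫ x : ι → ℝ × ℝ, ((x i).1 * linForm Prod.fst (a i) x) *
        steinSol z (biForm Prod.fst a x) ∂(Measure.pi fun _ => ν.prod ν)| ≤
    ∫ x : ι → ℝ × ℝ, (((x i).1 - (x i).2) * |(x i).1 - (x i).2| *
      (linForm Prod.fst (a i) x * |linForm Prod.fst (a i) x|)) *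
      steinOsc z (biForm Prod.fst a x) ∂(Measure.pi fun _ => ν.prod ν) := by
  set P : Measure (ι → ℝ × ℝ) := Measure.pi fun _ => ν.prod ν
  have mL := measurable_linForm (S := ℝ × ℝ) measurable_fst (a i)
  have mW := measurable_biForm (S := ℝ × ℝ) measurable_fst a
  have mx : Measurable fun x : ι → ℝ × ℝ => (x i).1 := by fun_prop
  have my : Measurable fun x : ι → ℝ × ℝ => (x i).2 := by fun_prop
  have key : ∀ u : ℝ × ℝ → ℝ, Measurable u → (∀ s, u s ^ 2 ≤ 2 * pairWeight s ^ 2) →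
      Integrable (fun x : ι → ℝ × ℝ => (u (x i) * linForm Prod.fst (a i) x) ^ 2) P :=
    fun u hu hup => integrable_diff_mul_linForm_sq h1 h2 h4 (ha0 i) hu hup
  have i1 := key (fun s => s.1) measurable_fst fun s => by
    unfold pairWeight; nlinarith [sq_nonneg s.1, sq_nonneg s.2, sq_nonneg (s.1 ^ 2 + s.2 ^ 2)]
  have i2 := key (fun s => s.2) measurable_snd fun s => by
    unfold pairWeight; nlinarith [sq_nonneg s.1, sq_nonneg s.2, sq_nonneg (s.1 ^ 2 + s.2 ^ 2)]
  have i3 := key (fun s => s.1 - s.2) (by fun_prop) fun s => by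
    unfold pairWeight
    nlinarith [sq_nonneg s.1, sq_nonneg s.2, sq_nonneg (s.1 ^ 2 + s.2 ^ 2), sq_nonneg (s.1 + s.2)]
  have sqint : ∀ f : (ι → ℝ × ℝ) → ℝ, Measurable f → Integrable (fun x => f x ^ 2) P →
      Integrable f P := fun f hf hf2 => by
    simpa using integrable_mul_of_sq hf measurable_const hf2 (g := fun _ => 1) (integrable_const _)
  have j1 := integrable_mul_comp_of_bdd mW (measurable_steinSol z) (exists_abs_steinSol_le z)
    (sqint _ (mx.mul mL) i1)
  have j2 := integrable_mul_comp_of_bdd mW (measurable_steinSol z) (exists_abs_steinSol_le z)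
    (sqint _ (my.mul mL) i2)
  have h := abs_stein_exchange_le (measurePreserving_swap_coord (ν := ν) i) mW
    (D := fun x => 2 * ((x i).1 - (x i).2) * linForm Prod.fst (a i) x) (by fun_prop)
    (fun x => biForm_update Prod.fst ha ha0 i x _)
    (fun x => by
      rw [freeOf_linForm (ha0 i) x, Function.update_self, Prod.fst_swap, Prod.snd_swap]; ring)
    (by
      refine (i3.const_mul 4).congr (.of_forall fun x => ?_)
      simp only; ring) z
  have e1 : ∫ x : ι → ℝ × ℝ, (2 * ((x i).1 - (x i).2) * linForm Prod.fst (a i) x) ^ 2 *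
      steinDeriv z (biForm Prod.fst a x) ∂P =
      4 * ∫ x : ι → ℝ × ℝ, (((x i).1 - (x i).2) ^ 2 * linForm Prod.fst (a i) x ^ 2) *
        steinDeriv z (biForm Prod.fst a x) ∂P := by
    rw [← integral_const_mul]; congr 1; funext x; ring
  -- The copy drops out of the linear term, because the form uses first coordinates only.
  have e0 : ∫ x : ι → ℝ × ℝ, ((x i).2 * linForm Prod.fst (a i) x) *
      steinSol z (biForm Prod.fst a x) ∂P = 0 := by
    have := integral_snd_mul_comp_fst (ν := ν) h1 i
      (G := fun y => linForm id (a i) y * steinSol z (biForm id a y))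
      ((measurable_linForm measurable_id _).mul
        ((measurable_steinSol z).comp (measurable_biForm measurable_id _)))
    rw [← this]
    congr 1; funext x
    simp only [linForm, biForm, id]
    ring
  have e2 : ∫ x : ι → ℝ × ℝ, (2 * ((x i).1 - (x i).2) * linForm Prod.fst (a i) x) *
      steinSol z (biForm Prod.fst a x) ∂P =
      2 * ∫ x : ι → ℝ × ℝ, ((x i).1 * linForm Prod.fst (a i) x) *
        steinSol z (biForm Prod.fst a x) ∂P := by
    have := integral_sub j1 j2
    simp only [Pi.mul_apply] at this
    rw [e0, sub_zero] at this
    rw [← this, ← integral_const_mul]; congr 1; funext x; ring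
  have e3 : ∫ x : ι → ℝ × ℝ, (2 * ((x i).1 - (x i).2) * linForm Prod.fst (a i) x) *
      |2 * ((x i).1 - (x i).2) * linForm Prod.fst (a i) x| *
      steinOsc z (biForm Prod.fst a x) ∂P =
      4 * ∫ x : ι → ℝ × ℝ, (((x i).1 - (x i).2) * |(x i).1 - (x i).2| *
        (linForm Prod.fst (a i) x * |linForm Prod.fst (a i) x|)) *
        steinOsc z (biForm Prod.fst a x) ∂P := by
    rw [← integral_const_mul]; congr 1; funext x
    rw [abs_mul, abs_mul, abs_two]; ring
  rw [e1, e2, e3] at h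
  rw [abs_le] at h ⊢
  constructor <;> linarith [h.1, h.2]

end Main

/-- The sum is the quadratic form of `a²`, split into diagonal and off-diagonal parts: the diagonal
has a nonzero mean, while the rest is again a form with zero diagonal. -/
theorem sum_linForm_sq {ι S : Type*} [Fintype ι] [DecidableEq ι] (X : S → ℝ) {a : ι → ι → ℝ}
    (ha : ∀ i j, a i j = a j i) (x : ι → S) :
    ∑ i, linForm X (a i) x ^ 2 = (∑ i, (∑ k, a i k ^ 2) * X (x i) ^ 2) +
      biForm X (fun i j => if i = j then 0 else ∑ k, a i k * a j k) x := by
  have h1 : ∑ i, linForm X (a i) x ^ 2 =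
      ∑ j, ∑ l, (∑ k, a j k * a l k) * X (x j) * X (x l) := by
    have e : ∀ i, linForm X (a i) x ^ 2 =
        ∑ j, ∑ l, (a j i * X (x j)) * (a l i * X (x l)) := fun i => by
      rw [sq, linForm, Finset.sum_mul_sum]
      simp only [ha i]
    simp only [e]
    rw [Finset.sum_comm]
    refine Finset.sum_congr rfl fun j _ => ?_
    rw [Finset.sum_comm]
    refine Finset.sum_congr rfl fun l _ => ?_
    rw [Finset.sum_mul, Finset.sum_mul]
    exact Finset.sum_congr rfl fun i _ => by ring
  rw [h1, biForm, ← Finset.sum_add_distrib]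
  refine Finset.sum_congr rfl fun j _ => ?_
  have h2 : (∑ k, a j k ^ 2) * X (x j) ^ 2 =
      ∑ l, if j = l then (∑ k, a j k * a l k) * X (x j) * X (x l) else 0 := by
    simp only [Finset.sum_ite_eq, Finset.mem_univ, if_true]
    rw [mul_assoc, ← sq]
    simp only [← sq]
  rw [h2, ← Finset.sum_add_distrib]
  refine Finset.sum_congr rfl fun l _ => ?_
  split_ifs <;> ring

section Variation

variable {ι : Type*} [Fintype ι] {a : ι → ι → ℝ}

/-- Sum of the squared increments of the quadratic form over the pairs. -/
def quadVar (a : ι → ι → ℝ) (x : ι → ℝ × ℝ) : ℝ :=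
  ∑ i, ((x i).1 - (x i).2) ^ 2 * linForm Prod.fst (a i) x ^ 2

/-- Sum of the signed squared increments of the quadratic form over the pairs. -/
def signedVar (a : ι → ι → ℝ) (x : ι → ℝ × ℝ) : ℝ :=
  ∑ i, ((x i).1 - (x i).2) * |(x i).1 - (x i).2| *
    (linForm Prod.fst (a i) x * |linForm Prod.fst (a i) x|)

theorem measurable_quadVar : Measurable (quadVar a) := by
  have := fun i => measurable_linForm (S := ℝ × ℝ) measurable_fst (a i)
  unfold quadVar
  fun_prop

theorem measurable_signedVar : Measurable (signedVar a) := by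
  have := fun i => measurable_linForm (S := ℝ × ℝ) measurable_fst (a i)
  unfold signedVar
  fun_prop

end Variation

section Main

variable {ι : Type*} [Fintype ι] [DecidableEq ι] {ν : Measure ℝ} [IsProbabilityMeasure ν]
  {b m : ℝ} {a : ι → ι → ℝ}

/-- Sum of the coordinate inequalities; no normalising factor remains because `∑ X_i L_i` is the
form itself. -/
theorem abs_stein_biForm_le (h1 : ∫ t, t ∂ν = 0) (h2 : ∫ t, t ^ 2 ∂ν = 1)
    (h4 : Integrable (fun t => t ^ 4) ν) (ha : ∀ i j, a i j = a j i) (ha0 : ∀ i, a i i = 0)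
    (z : ℝ) :
    |∫ x : ι → ℝ × ℝ, quadVar a x * steinDeriv z (biForm Prod.fst a x)
        ∂(Measure.pi fun _ => ν.prod ν) -
      ∫ x : ι → ℝ × ℝ, biForm Prod.fst a x * steinSol z (biForm Prod.fst a x)
        ∂(Measure.pi fun _ => ν.prod ν)| ≤
    ∫ x : ι → ℝ × ℝ, signedVar a x * steinOsc z (biForm Prod.fst a x)
      ∂(Measure.pi fun _ => ν.prod ν) := by
  set P : Measure (ι → ℝ × ℝ) := Measure.pi fun _ => ν.prod ν
  have mL := fun i => measurable_linForm (S := ℝ × ℝ) measurable_fst (a i)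
  have mW := measurable_biForm (S := ℝ × ℝ) measurable_fst a
  have key : ∀ i, ∀ u : ℝ × ℝ → ℝ, Measurable u → (∀ s, u s ^ 2 ≤ 2 * pairWeight s ^ 2) →
      Integrable (fun x : ι → ℝ × ℝ => (u (x i) * linForm Prod.fst (a i) x) ^ 2) P :=
    fun i u hu hup => integrable_diff_mul_linForm_sq h1 h2 h4 (ha0 i) hu hup
  have i1 := fun i => key i (fun s => s.1) measurable_fst fun s => by
    unfold pairWeight; nlinarith [sq_nonneg s.1, sq_nonneg s.2, sq_nonneg (s.1 ^ 2 + s.2 ^ 2)]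
  have i3 := fun i => key i (fun s => s.1 - s.2) (by fun_prop) fun s => by
    unfold pairWeight
    nlinarith [sq_nonneg s.1, sq_nonneg s.2, sq_nonneg (s.1 ^ 2 + s.2 ^ 2), sq_nonneg (s.1 + s.2)]
  have iq : ∀ i, Integrable (fun x : ι → ℝ × ℝ =>
      ((x i).1 - (x i).2) ^ 2 * linForm Prod.fst (a i) x ^ 2) P := fun i => by
    simpa only [mul_pow] using i3 i
  have is : ∀ i, Integrable (fun x : ι → ℝ × ℝ =>
      ((x i).1 - (x i).2) * |(x i).1 - (x i).2| *
        (linForm Prod.fst (a i) x * |linForm Prod.fst (a i) x|)) P := fun i => by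
    have := mL i
    refine (iq i).mono' (by fun_prop) (.of_forall fun x => ?_)
    rw [Real.norm_eq_abs, abs_mul, abs_mul, abs_mul, abs_abs, abs_abs, ← sq, ← sq, sq_abs, sq_abs]
  have il : ∀ i, Integrable (fun x : ι → ℝ × ℝ => (x i).1 * linForm Prod.fst (a i) x) P :=
    fun i => by
      have := mL i
      simpa using integrable_mul_of_sq (f := fun x : ι → ℝ × ℝ => (x i).1 *
        linForm Prod.fst (a i) x) (by fun_prop) measurable_const (i1 i) (g := fun _ => 1)
        (integrable_const _)
  have jq := fun i => integrable_mul_comp_of_bdd mW (measurable_steinDeriv z)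
    (exists_abs_steinDeriv_le z) (iq i)
  have js := fun i => integrable_mul_comp_of_bdd mW (measurable_steinOsc z)
    (exists_abs_steinOsc_le z) (is i)
  have jl := fun i => integrable_mul_comp_of_bdd mW (measurable_steinSol z)
    (exists_abs_steinSol_le z) (il i)
  have eW : ∀ x : ι → ℝ × ℝ, biForm Prod.fst a x * steinSol z (biForm Prod.fst a x) =
      ∑ i, ((x i).1 * linForm Prod.fst (a i) x) * steinSol z (biForm Prod.fst a x) := fun x => by
    rw [← Finset.sum_mul, ← biForm_eq_sum_mul_linForm]
  simp only [eW]
  simp only [quadVar, signedVar, Finset.sum_mul]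
  rw [integral_finsetSum _ fun i _ => jq i, integral_finsetSum _ fun i _ => js i,
    integral_finsetSum _ fun i _ => jl i, ← Finset.sum_sub_distrib]
  exact (Finset.abs_sum_le_sum_abs _ _).trans
    (Finset.sum_le_sum fun i _ => abs_stein_biForm_coord_le h1 h2 h4 ha ha0 z i)

theorem signedVar_sq (h1 : ∫ t, t ∂ν = 0) (h2 : ∫ t, t ^ 2 ∂ν = 1)
    (h4 : Integrable (fun t => t ^ 4) ν) (hm : ∫ s, pairWeight s ^ 2 ∂(ν.prod ν) = m)
    (ha : ∀ i j, a i j = a j i) (ha0 : ∀ i, a i i = 0) :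
    Integrable (fun x : ι → ℝ × ℝ => signedVar a x ^ 2) (Measure.pi fun _ => ν.prod ν) ∧
    ∫ x : ι → ℝ × ℝ, signedVar a x ^ 2 ∂(Measure.pi fun _ => ν.prod ν) ≤
      272 * m ^ 3 * ∑ i, (∑ k, a i k ^ 2) ^ 2 := by
  exact weighted_sum_sq (ρ := ν.prod ν) (X := Prod.fst) (p := pairWeight)
    (g := fun s => (s.1 - s.2) * |s.1 - s.2|) (φ := fun _ u => u * |u|) measurable_fst
    ((integral_fst_comp (u := fun t => t) (by fun_prop)).trans h1)
    ((integral_fst_comp (u := fun t => t ^ 2) (by fun_prop)).trans h2) (integrable_fst_comp h4)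
    (integral_fst_comp (u := fun t => t ^ 4) (by fun_prop))
    (hm ▸ le_integral_pairWeight_sq h4 rfl) measurable_pairWeight (integrable_pairWeight_sq h4) hm
    (fun s => by
      unfold pairWeight
      rw [abs_le]
      constructor <;> nlinarith [sq_nonneg s.2, sq_nonneg (s.1 - 1), sq_nonneg (s.1 + 1)])
    (fun s => by unfold pairWeight; nlinarith [sq_nonneg s.2]) (by fun_prop) abs_diff_mul_abs_le
    integral_diff_mul_abs ha ha0 (fun _ => by fun_prop)
    (fun i u => by
      rw [abs_mul, abs_abs, ← sq, sq_abs]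
      have : 0 ≤ ∑ k, a i k ^ 2 := Finset.sum_nonneg fun k _ => sq_nonneg _
      linarith)
    (fun _ => abs_mul_abs_sub_le)

theorem one_sub_quadVar_sq (h1 : ∫ t, t ∂ν = 0) (h2 : ∫ t, t ^ 2 ∂ν = 1)
    (h4 : Integrable (fun t => t ^ 4) ν) (hm : ∫ s, pairWeight s ^ 2 ∂(ν.prod ν) = m)
    (ha : ∀ i j, a i j = a j i) (ha0 : ∀ i, a i i = 0) (hs : ∑ i, ∑ k, a i k ^ 2 = 1 / 2) :
    Integrable (fun x : ι → ℝ × ℝ => (1 - quadVar a x) ^ 2) (Measure.pi fun _ => ν.prod ν) ∧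
    ∫ x : ι → ℝ × ℝ, (1 - quadVar a x) ^ 2 ∂(Measure.pi fun _ => ν.prod ν) ≤
      4464 * m ^ 3 * (∑ i, (∑ k, a i k ^ 2) ^ 2 + ∑ i, ∑ j, (∑ k, a i k * a j k) ^ 2) := by
  have hX0 := (integral_fst_comp (ν := ν) (u := fun t => t) (by fun_prop)).trans h1
  have hX2 := (integral_fst_comp (ν := ν) (u := fun t => t ^ 2) (by fun_prop)).trans h2
  have hX4 := integrable_fst_comp h4
  have hb := integral_fst_comp (ν := ν) (u := fun t => t ^ 4) (by fun_prop)
  have hbm := hm ▸ le_integral_pairWeight_sq h4 rfl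
  have hb1 := hb ▸ one_le_fourth_moment (ρ := ν.prod ν) measurable_fst hX2 hX4
  have hXp : ∀ s : ℝ × ℝ, |s.1| ≤ pairWeight s := fun s => by
    unfold pairWeight
    rw [abs_le]
    constructor <;> nlinarith [sq_nonneg s.2, sq_nonneg (s.1 - 1), sq_nonneg (s.1 + 1)]
  have hXp2 : ∀ s : ℝ × ℝ, s.1 ^ 2 ≤ pairWeight s := fun s => by
    unfold pairWeight; nlinarith [sq_nonneg s.2]
  have ht : ∀ i, 0 ≤ ∑ k, a i k ^ 2 := fun i => Finset.sum_nonneg fun k _ => sq_nonneg _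
  obtain ⟨q1, q2⟩ := weighted_sum_sq (ρ := ν.prod ν) (X := Prod.fst) (p := pairWeight)
    (g := fun s => (s.1 - s.2) ^ 2 - 2) (φ := fun _ u => u ^ 2) measurable_fst hX0 hX2 hX4 hb hbm
    measurable_pairWeight (integrable_pairWeight_sq h4) hm hXp hXp2 (by fun_prop)
    abs_sq_diff_sub_two_le (integral_sq_diff_sub_two h4 h1 h2) ha ha0 (fun _ => by fun_prop)
    (fun i u => by
      rw [abs_of_nonneg (sq_nonneg u)]
      linarith [ht i])
    (fun _ u v => by
      rw [show u ^ 2 - v ^ 2 = (u - v) * (u + v) by ring, abs_mul]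
      exact mul_le_mul_of_nonneg_left (abs_add_le u v) (abs_nonneg _))
  obtain ⟨r1, r2⟩ := weighted_sum_sq (ρ := ν.prod ν) (X := Prod.fst) (p := pairWeight)
    (g := fun s => s.1 ^ 2 - 1) (φ := fun i _ => ∑ k, a i k ^ 2) measurable_fst hX0 hX2 hX4 hb hbm
    measurable_pairWeight (integrable_pairWeight_sq h4) hm hXp hXp2 (by fun_prop)
    abs_sq_sub_one_le (integral_sq_sub_one h4 h2) ha ha0 (fun _ => by fun_prop)
    (fun i u => by
      rw [abs_of_nonneg (ht i)]
      linarith [sq_nonneg u])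
    (fun _ u v => by rw [sub_self, abs_zero]; positivity)
  set B : ι → ι → ℝ := fun i j => if i = j then 0 else ∑ k, a i k * a j k with hB
  obtain ⟨v1, v2⟩ := fourth_moment_biForm (ρ := ν.prod ν) measurable_fst hX0 hX2 hX4 hb (a := B)
    (fun i j => by
      simp only [hB, eq_comm (a := j)]
      congr 1
      exact Finset.sum_congr rfl fun k _ => mul_comm _ _) (fun i => by simp [hB])
  have mV := measurable_biForm (S := ℝ × ℝ) measurable_fst B
  have hB0 : 0 ≤ ∑ i, ∑ j, B i j ^ 2 :=
    Finset.sum_nonneg fun i _ => Finset.sum_nonneg fun j _ => sq_nonneg _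
  obtain ⟨w1, w2⟩ := integral_sq_le_of_fourth (by positivity) mV v1 v2
  have hBle : ∑ i, ∑ j, B i j ^ 2 ≤ ∑ i, ∑ j, (∑ k, a i k * a j k) ^ 2 :=
    Finset.sum_le_sum fun i _ => Finset.sum_le_sum fun j _ => by
      simp only [hB]
      split_ifs
      · simp only [ne_eq, OfNat.ofNat_ne_zero, not_false_eq_true, zero_pow]; exact sq_nonneg _
      · exact le_rfl
  -- Replacing `(x - x')²` by its mean 2 leaves `2 ∑ L_i²`, whose mean is 1 because `∑ a i k ^ 2 = 1
  -- / 2`; its fluctuation splits into the diagonal and off-diagonal parts of `a²`.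
  have e : ∀ x : ι → ℝ × ℝ, 1 - quadVar a x =
      -(∑ i, (((x i).1 - (x i).2) ^ 2 - 2) * linForm Prod.fst (a i) x ^ 2 +
        2 * ∑ i, ((x i).1 ^ 2 - 1) * ∑ k, a i k ^ 2) - 2 * biForm Prod.fst B x := by
    intro x
    have h := sum_linForm_sq Prod.fst ha x
    have c1 : ∑ i, (((x i).1 - (x i).2) ^ 2 - 2) * linForm Prod.fst (a i) x ^ 2 =
        quadVar a x - 2 * ∑ i, linForm Prod.fst (a i) x ^ 2 := by
      simp only [quadVar, sub_mul, Finset.sum_sub_distrib, Finset.mul_sum]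
    have c2 : ∑ i, ((x i).1 ^ 2 - 1) * ∑ k, a i k ^ 2 =
        ∑ i, (∑ k, a i k ^ 2) * (x i).1 ^ 2 - 1 / 2 := by
      rw [← hs, ← Finset.sum_sub_distrib]
      exact Finset.sum_congr rfl fun i _ => by ring
    rw [c1, c2, h]
    ring
  -- The inequality `(p + 2 q + 2 v)² ≤ 3 (p² + 4 q² + 4 v²)`; hence `4464 = (3 + 12) * 272 + 12 *
  -- 32`.
  have ipt : ∀ x : ι → ℝ × ℝ, (1 - quadVar a x) ^ 2 ≤
      3 * (∑ i, (((x i).1 - (x i).2) ^ 2 - 2) * linForm Prod.fst (a i) x ^ 2) ^ 2 +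
        12 * (∑ i, ((x i).1 ^ 2 - 1) * ∑ k, a i k ^ 2) ^ 2 + 12 * biForm Prod.fst B x ^ 2 := by
    intro x
    rw [e x]
    set p := ∑ i, (((x i).1 - (x i).2) ^ 2 - 2) * linForm Prod.fst (a i) x ^ 2
    set q := ∑ i, ((x i).1 ^ 2 - 1) * ∑ k, a i k ^ 2
    nlinarith [sq_nonneg (p - 2 * q), sq_nonneg (p - 2 * biForm Prod.fst B x),
      sq_nonneg (q - biForm Prod.fst B x)]
  have iD := ((q1.const_mul 3).add (r1.const_mul 12)).add (w1.const_mul 12)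
  refine ⟨iD.mono' ((measurable_const.sub measurable_quadVar).pow_const 2).aestronglyMeasurable
    (.of_forall fun x => ?_), ?_⟩
  · rw [Real.norm_of_nonneg (sq_nonneg _)]; exact ipt x
  refine (integral_mono_of_nonneg (.of_forall fun x => sq_nonneg _) iD (.of_forall ipt)).trans ?_
  rw [integral_add' ((q1.const_mul 3).add (r1.const_mul 12)) (w1.const_mul 12),
    integral_add' (q1.const_mul 3) (r1.const_mul 12), integral_const_mul, integral_const_mul,
    integral_const_mul]
  set β := ∑ i, ∑ j, (∑ k, a i k * a j k) ^ 2
  set b := ∫ t, t ^ 4 ∂ν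
  have hm1 : 1 ≤ m := hb1.trans hbm
  have g1 : b ^ 2 * ∑ i, ∑ j, B i j ^ 2 ≤ m ^ 3 * β := by
    refine mul_le_mul ?_ hBle hB0 (by positivity)
    calc b ^ 2 ≤ m ^ 2 := pow_le_pow_left₀ (by linarith) hbm 2
      _ ≤ m ^ 3 := pow_le_pow_right₀ hm1 (by norm_num)
  have g2 : 0 ≤ m ^ 3 * β := mul_nonneg (by positivity)
    (Finset.sum_nonneg fun i _ => Finset.sum_nonneg fun j _ => sq_nonneg _)
  have g3 : 0 ≤ m ^ 3 * ∑ i, (∑ k, a i k ^ 2) ^ 2 := mul_nonneg (by positivity)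
    (Finset.sum_nonneg fun i _ => sq_nonneg _)
  linarith

/-- Here the Stein error is assembled and Cauchy–Schwarz applied; `m ≤ 9 b` returns the bounds to
the fourth moment. -/
theorem nonuniform_bound_biForm (h1 : ∫ t, t ∂ν = 0) (h2 : ∫ t, t ^ 2 ∂ν = 1)
    (h4 : Integrable (fun t => t ^ 4) ν) (hb : ∫ t, t ^ 4 ∂ν = b)
    (ha : ∀ i j, a i j = a j i) (ha0 : ∀ i, a i i = 0) (hs : ∑ i, ∑ k, a i k ^ 2 = 1 / 2)
    (z : ℝ) :
    |(Measure.pi fun _ => ν.prod ν).real {x : ι → ℝ × ℝ | biForm Prod.fst a x ≤ z} -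
      stdNormalCDF z| ≤ 2496420 * b ^ 4 / (1 + |z|) ^ 2 *
        (Real.sqrt (∑ i, (∑ k, a i k ^ 2) ^ 2) +
          Real.sqrt (∑ i, ∑ j, (∑ k, a i k * a j k) ^ 2)) := by
  set P : Measure (ι → ℝ × ℝ) := Measure.pi fun _ => ν.prod ν
  obtain ⟨m, hm⟩ : ∃ m, ∫ s, pairWeight s ^ 2 ∂(ν.prod ν) = m := ⟨_, rfl⟩
  have hb1 : 1 ≤ b := hb ▸ one_le_fourth_moment (ρ := ν) measurable_id h2 h4
  have hbm : b ≤ m := hm ▸ le_integral_pairWeight_sq h4 hb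
  have hmb : m ≤ 9 * b := by
    have := integral_pairWeight_sq_le h4 hb
    rw [hm] at this; linarith
  have hm1 : 1 ≤ m := hb1.trans hbm
  have mW := measurable_biForm (S := ℝ × ℝ) measurable_fst a
  obtain ⟨s1, s2⟩ := signedVar_sq h1 h2 h4 hm ha ha0
  obtain ⟨d1, d2⟩ := one_sub_quadVar_sq h1 h2 h4 hm ha ha0 hs
  obtain ⟨w1, w2⟩ := fourth_moment_biForm (ρ := ν.prod ν) measurable_fst
    ((integral_fst_comp (u := fun t => t) (by fun_prop)).trans h1)
    ((integral_fst_comp (u := fun t => t ^ 2) (by fun_prop)).trans h2) (integrable_fst_comp h4)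
    ((integral_fst_comp (u := fun t => t ^ 4) (by fun_prop)).trans hb) ha ha0
  set A₁ := ∑ i, (∑ k, a i k ^ 2) ^ 2
  set A₂ := ∑ i, ∑ j, (∑ k, a i k * a j k) ^ 2
  have hA1 : 0 ≤ A₁ := Finset.sum_nonneg fun i _ => sq_nonneg _
  have hA2 : 0 ≤ A₂ := Finset.sum_nonneg fun i _ => Finset.sum_nonneg fun j _ => sq_nonneg _
  clear_value A₁ A₂
  set R := Real.sqrt A₁ + Real.sqrt A₂
  have hR : 0 ≤ R := by positivity
  have hR2 : A₁ + A₂ ≤ R ^ 2 := by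
    have g1 := Real.sq_sqrt hA1
    have g2 := Real.sq_sqrt hA2
    have g3 := mul_nonneg (Real.sqrt_nonneg A₁) (Real.sqrt_nonneg A₂)
    calc A₁ + A₂ ≤ Real.sqrt A₁ ^ 2 + Real.sqrt A₂ ^ 2 +
          2 * (Real.sqrt A₁ * Real.sqrt A₂) := by linarith
      _ = R ^ 2 := by ring
  clear_value R
  have hm34 : m ^ 3 ≤ m ^ 4 := pow_le_pow_right₀ hm1 (by norm_num)
  -- The constant comes from `4464 ≤ 67 ^ 2`, and `m ^ 3 ≤ m ^ 4` makes the bound a perfect square.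
  have hd : ∫ x, (1 - quadVar a x) ^ 2 ∂P ≤ (67 * m ^ 2 * R) ^ 2 := by
    refine d2.trans ?_
    have g1 := mul_le_mul hm34 hR2 (by linarith) (by positivity)
    have g2 : 0 ≤ m ^ 4 * R ^ 2 := by positivity
    linarith
  have hsv : ∫ x, signedVar a x ^ 2 ∂P ≤ (67 * m ^ 2 * R) ^ 2 := by
    refine s2.trans ?_
    have g1 := mul_le_mul hm34 (by linarith : A₁ ≤ R ^ 2) hA1 (by positivity)
    have g2 : 0 ≤ m ^ 4 * R ^ 2 := by positivity
    linarith
  -- The fourth moment of the form is at most `(16 b²)²`, and `2 + 2 * 256 b⁴ ≤ (23 b²)²`.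
  have hw : ∀ (u : ℝ → ℝ) (κ : ℝ), 0 ≤ κ → Measurable u → (∀ w, |u w| ≤ κ * (1 + w ^ 2)) →
      Integrable (fun x => u (biForm Prod.fst a x) ^ 2) P ∧
      ∫ x, u (biForm Prod.fst a x) ^ 2 ∂P ≤ (κ * (23 * b ^ 2)) ^ 2 := by
    intro u κ hκ hu hub
    have ipt : ∀ x : ι → ℝ × ℝ, u (biForm Prod.fst a x) ^ 2 ≤
        κ ^ 2 * (2 + 2 * biForm Prod.fst a x ^ 4) := fun x => by
      have h1 := sq_le_sq.2 ((hub (biForm Prod.fst a x)).trans (le_abs_self _))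
      refine h1.trans ?_
      rw [mul_pow]
      refine mul_le_mul_of_nonneg_left ?_ (sq_nonneg κ)
      nlinarith [sq_nonneg (biForm Prod.fst a x ^ 2 - 1)]
    have i0 : Integrable (fun _ : ι → ℝ × ℝ => (2 : ℝ)) P := integrable_const _
    have iD := (i0.add (w1.const_mul 2)).const_mul (κ ^ 2)
    refine ⟨iD.mono' ((hu.comp mW).pow_const 2).aestronglyMeasurable (.of_forall fun x => ?_), ?_⟩
    · rw [Real.norm_of_nonneg (sq_nonneg _)]; exact ipt x
    refine (integral_mono_of_nonneg (.of_forall fun x => sq_nonneg _) iD (.of_forall ipt)).trans ?_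
    rw [integral_const_mul, integral_add' i0 (w1.const_mul 2), integral_const_mul,
      integral_const, mul_pow]
    refine mul_le_mul_of_nonneg_left ?_ (sq_nonneg κ)
    rw [hs] at w2
    have : 1 ≤ b ^ 4 := one_le_pow₀ hb1
    simp only [probReal_univ, smul_eq_mul]
    linarith
  set κ := ((1 + |z|) ^ 2)⁻¹ with hκ
  have hκ0 : 0 ≤ κ := by positivity
  obtain ⟨k1, k2⟩ := hw (steinDeriv z) (12 * κ) (by positivity) (measurable_steinDeriv z)
    fun w => abs_steinDeriv_le z w
  obtain ⟨o1, o2⟩ := hw (steinOsc z) (8 * κ) (by positivity) (measurable_steinOsc z)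
    fun w => abs_steinOsc_le z w
  have mk : Measurable fun x : ι → ℝ × ℝ => steinDeriv z (biForm Prod.fst a x) :=
    (measurable_steinDeriv z).comp mW
  have mo : Measurable fun x : ι → ℝ × ℝ => steinOsc z (biForm Prod.fst a x) :=
    (measurable_steinOsc z).comp mW
  have mq : Measurable fun x : ι → ℝ × ℝ => 1 - quadVar a x :=
    measurable_const.sub measurable_quadVar
  have b1 := abs_integral_mul_le (by positivity) (by positivity) mq mk d1 k1 hd k2
  have b2 := (le_abs_self _).trans
    (abs_integral_mul_le (by positivity) (by positivity) measurable_signedVar mo s1 o1 hsv o2)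
  have b3 := abs_stein_biForm_le h1 h2 h4 ha ha0 z
  have ik : Integrable (fun x => steinDeriv z (biForm Prod.fst a x)) P := by
    simpa using integrable_mul_of_sq mk measurable_const k1 (g := fun _ => 1) (integrable_const _)
  have ikq := integrable_mul_of_sq mq mk d1 k1
  have iwf : Integrable (fun x => biForm Prod.fst a x * steinSol z (biForm Prod.fst a x)) P := by
    refine (integrable_const (1 + |z| * (millsRatio z + millsRatio (-z)))).mono'
      (mW.mul ((measurable_steinSol z).comp mW)).aestronglyMeasurable (.of_forall fun x => ?_)
    exact abs_mul_steinSol_le_const z _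
  have hset : MeasurableSet {x : ι → ℝ × ℝ | biForm Prod.fst a x ≤ z} :=
    measurableSet_le mW measurable_const
  have hP : ∫ x, steinDeriv z (biForm Prod.fst a x) ∂P -
      ∫ x, biForm Prod.fst a x * steinSol z (biForm Prod.fst a x) ∂P =
      P.real {x : ι → ℝ × ℝ | biForm Prod.fst a x ≤ z} - stdNormalCDF z := by
    have e : ∀ x : ι → ℝ × ℝ, steinDeriv z (biForm Prod.fst a x) -
        biForm Prod.fst a x * steinSol z (biForm Prod.fst a x) =
        {x : ι → ℝ × ℝ | biForm Prod.fst a x ≤ z}.indicator 1 x - stdNormalCDF z := fun x => by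
      rw [steinDeriv, add_assoc, add_sub_cancel_left, steinStep_add_steinConst]
      simp only [indicator, mem_ofPred_eq, Pi.one_apply]
    rw [← integral_sub ik iwf]
    simp only [e]
    have i1 : Integrable ({x : ι → ℝ × ℝ | biForm Prod.fst a x ≤ z}.indicator 1) P :=
      (integrable_const (1 : ℝ)).indicator hset
    rw [integral_sub i1 (integrable_const _),
      integral_indicator_one hset]
    simp
  have hK : ∫ x, (1 - quadVar a x) * steinDeriv z (biForm Prod.fst a x) ∂P =
      ∫ x, steinDeriv z (biForm Prod.fst a x) ∂P -
        ∫ x, quadVar a x * steinDeriv z (biForm Prod.fst a x) ∂P := by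
    have iqk : Integrable (fun x => quadVar a x * steinDeriv z (biForm Prod.fst a x)) P := by
      refine (ik.sub ikq).congr (.of_forall fun x => ?_)
      simp only [Pi.sub_apply]; ring
    rw [← integral_sub ik iqk]
    congr 1; funext x; ring
  rw [hK] at b1
  rw [← hP]
  -- The final constant is `67 * 23 * (12 + 8) * 9 ^ 2`.
  have hfin : 67 * m ^ 2 * R * (12 * κ * (23 * b ^ 2)) + 67 * m ^ 2 * R * (8 * κ * (23 * b ^ 2)) ≤
      2496420 * b ^ 4 / (1 + |z|) ^ 2 * R := by
    have : m ^ 2 ≤ (9 * b) ^ 2 := pow_le_pow_left₀ (by linarith) hmb 2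
    have h5 := mul_le_mul_of_nonneg_right this (by positivity : 0 ≤ R * κ * b ^ 2)
    rw [div_eq_mul_inv, ← hκ]
    linarith
  refine le_trans ?_ ((add_le_add b1 b2).trans hfin)
  rw [abs_le] at b3
  have := neg_abs_le (∫ x, steinDeriv z (biForm Prod.fst a x) ∂P -
        ∫ x, quadVar a x * steinDeriv z (biForm Prod.fst a x) ∂P)
  have := le_abs_self (∫ x, steinDeriv z (biForm Prod.fst a x) ∂P -
        ∫ x, quadVar a x * steinDeriv z (biForm Prod.fst a x) ∂P)
  rw [abs_le]
  constructor <;> linarith [b3.1, b3.2]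

end Main

/-! ### Normalisation and transfer to the given probability space. -/

theorem integral_pow_map {Ω : Type*} [MeasurableSpace Ω] {μ : Measure Ω} {Y : Ω → ℝ}
    (hY : Measurable Y) (k : ℕ) : ∫ t, t ^ k ∂(μ.map Y) = ∫ ω, Y ω ^ k ∂μ :=
  integral_map hY.aemeasurable (by fun_prop)

theorem quadForm_eq_biForm {n : ℕ} {Ω : Type*} {A : Matrix (Fin n) (Fin n) ℝ}
    (hA : ∀ i, A i i = 0) (X : Fin n → Ω → ℝ) (ω : Ω) :
    quadForm A X ω = biForm id (fun i j => (quadSigma A)⁻¹ * A i j) (fun i => X i ω) := by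
  rw [quadForm, biForm, Finset.mul_sum]
  refine Finset.sum_congr rfl fun i _ => ?_
  rw [Finset.mul_sum, Finset.sum_filter]
  refine Finset.sum_congr rfl fun j _ => ?_
  split_ifs with h
  · simp only [id]; ring
  · rw [not_not.1 h, hA]; simp

theorem quadSigma_sq {n : ℕ} (A : Matrix (Fin n) (Fin n) ℝ) :
    quadSigma A ^ 2 = 2 * ∑ i, ∑ j, A i j ^ 2 :=
  Real.sq_sqrt (mul_nonneg two_pos.le
    (Finset.sum_nonneg fun _ _ => Finset.sum_nonneg fun _ _ => sq_nonneg _))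

theorem quadSigma_pos {n : ℕ} {A : Matrix (Fin n) (Fin n) ℝ} (hA : A ≠ 0) : 0 < quadSigma A := by
  obtain ⟨i, j, hij⟩ : ∃ i j, A i j ≠ 0 := by
    by_contra! h
    exact hA (Matrix.ext h)
  refine Real.sqrt_pos.2 (mul_pos two_pos ?_)
  refine Finset.sum_pos' (fun _ _ => Finset.sum_nonneg fun _ _ => sq_nonneg _)
    ⟨i, Finset.mem_univ i, Finset.sum_pos' (fun j _ => sq_nonneg _) ⟨j, Finset.mem_univ j, ?_⟩⟩
  positivity

end Auxiliary

theorem theorem4p1 :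
    ∃ C : ℝ → ℝ,
      ∀ (n : ℕ) [NeZero n] (Ω : Type*) [MeasurableSpace Ω] (μ : Measure Ω) [IsProbabilityMeasure μ]
        (X : Fin n → Ω → ℝ) (A : Matrix (Fin n) (Fin n) ℝ),
        (∀ i, Measurable (X i)) →
        iIndepFun X μ →
        (∀ i, IdentDistrib (X i) (X 0) μ μ) →
        (∀ i, MemLp (X i) 4 μ) →
        (∀ i, ∫ ω, X i ω ∂μ = 0) →
        (∀ i, variance (X i) μ = 1) →
        A.IsSymm →
        (∀ i, A i i = 0) →
        A ≠ 0 →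
        ∀ z : ℝ,
          |μ.real {ω | quadForm A X ω ≤ z} - stdNormalCDF z| ≤
            C (∫ ω, X 0 ω ^ 4 ∂μ) * (∫ ω, X 0 ω ^ 4 ∂μ) / ((1 + |z|) ^ 2 * quadSigma A ^ 2) *
              (Real.sqrt (∑ i, (∑ j, A i j ^ 2) ^ 2) +
                Real.sqrt (∑ i, ∑ j, (∑ k, A i k * A j k) ^ 2)) := by
  -- One of the four powers of `b` in the bound is the explicit factor `E X⁴` of the statement.
  refine ⟨fun b => 2496420 * b ^ 3, ?_⟩
  intro n _ Ω _ μ _ X A hX hind hid hL4 hmean hvar hsymm hdiag hA z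
  have hσ := quadSigma_pos hA
  set σ := quadSigma A with hσdef
  set ν : Measure ℝ := μ.map (X 0) with hν
  have : IsProbabilityMeasure ν := Measure.isProbabilityMeasure_map (hX 0).aemeasurable
  have h1 : ∫ t, t ∂ν = 0 := by
    rw [hν, integral_map (hX 0).aemeasurable (by fun_prop)]; exact hmean 0
  have h2 : ∫ t, t ^ 2 ∂ν = 1 := by
    rw [hν, integral_pow_map (hX 0), ← hvar 0,
      variance_of_integral_eq_zero (hX 0).aemeasurable (hmean 0)]
  have h4 : Integrable (fun t => t ^ 4) ν := by
    rw [hν, integrable_map_measure (by fun_prop) (hX 0).aemeasurable]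
    have := (hL4 0).integrable_norm_pow (p := 4) (by norm_num)
    refine this.congr (.of_forall fun ω => ?_)
    simp only [Function.comp, Real.norm_eq_abs]
    exact Even.pow_abs (by decide) _
  set a : Fin n → Fin n → ℝ := fun i j => σ⁻¹ * A i j with ha
  have hs : ∑ i, ∑ k, a i k ^ 2 = 1 / 2 := by
    have h := quadSigma_sq A
    rw [← hσdef] at h
    simp only [ha, mul_pow, ← Finset.mul_sum]
    rw [inv_pow, inv_mul_eq_iff_eq_mul₀ (by positivity)]
    linarith
  have key := nonuniform_bound_biForm (ν := ν) (a := a) h1 h2 h4 (integral_pow_map (hX 0) 4)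
    (fun i j => by simp only [ha]; rw [hsymm.apply]) (fun i => by simp [ha, hdiag]) hs z
  have hm : Measurable (biForm (ι := Fin n) (id : ℝ → ℝ) a) := measurable_biForm measurable_id a
  have hset : MeasurableSet {y : Fin n → ℝ | biForm id a y ≤ z} :=
    measurableSet_le hm measurable_const
  have hlaw : μ.map (fun ω i => X i ω) = Measure.pi fun _ => ν := by
    rw [(iIndepFun_iff_map_fun_eq_pi_map fun i => (hX i).aemeasurable).1 hind]
    congr 1; funext i
    exact (hid i).map_eq
  -- The form ignores the copies, so its law on pairs is its law under `ν` in every coordinate,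
  -- which by independence is the joint law of the `X i`.
  have hprob : (Measure.pi fun _ => ν.prod ν).real
      {x : Fin n → ℝ × ℝ | biForm Prod.fst a x ≤ z} = μ.real {ω | quadForm A X ω ≤ z} := by
    have e1 := (measurePreserving_pi (fun _ : Fin n => ν.prod ν) (fun _ : Fin n => ν)
      (f := fun _ => Prod.fst) fun _ => measurePreserving_fst).measureReal_preimage
      hset.nullMeasurableSet
    have e2 := map_measureReal_apply (μ := μ) (f := fun ω i => X i ω) (by fun_prop) hset
    rw [hlaw, ← e1] at e2
    refine e2.trans ?_
    congr 1
    ext ω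
    simp only [Set.mem_preimage, Set.mem_ofPred_eq, quadForm_eq_biForm hdiag]
    rfl
  rw [hprob] at key
  refine key.trans (le_of_eq ?_)
  -- The radicand is homogeneous of degree 4 in the matrix, so scaling by `σ⁻¹` produces the factor
  -- `σ⁻²` of the statement.
  have r1 : Real.sqrt (∑ i, (∑ k, a i k ^ 2) ^ 2) =
      (σ ^ 2)⁻¹ * Real.sqrt (∑ i, (∑ j, A i j ^ 2) ^ 2) := by
    rw [← Real.sqrt_sq (by positivity : 0 ≤ (σ ^ 2)⁻¹), ← Real.sqrt_mul (sq_nonneg _)]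
    congr 1
    rw [Finset.mul_sum]
    refine Finset.sum_congr rfl fun i _ => ?_
    simp only [ha, mul_pow, ← Finset.mul_sum]
    rw [inv_pow]
  have r2 : Real.sqrt (∑ i, ∑ j, (∑ k, a i k * a j k) ^ 2) =
      (σ ^ 2)⁻¹ * Real.sqrt (∑ i, ∑ j, (∑ k, A i k * A j k) ^ 2) := by
    rw [← Real.sqrt_sq (by positivity : 0 ≤ (σ ^ 2)⁻¹), ← Real.sqrt_mul (sq_nonneg _)]
    congr 1
    rw [Finset.mul_sum]
    refine Finset.sum_congr rfl fun i _ => ?_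
    rw [Finset.mul_sum]
    refine Finset.sum_congr rfl fun j _ => ?_
    rw [← mul_pow, Finset.mul_sum]
    congr 1
    refine Finset.sum_congr rfl fun k _ => ?_
    simp only [ha]
    rw [sq, mul_inv]; ring
  rw [r1, r2, div_eq_mul_inv, div_eq_mul_inv, mul_inv]
  ring
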